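/- Let $\mathbb H$ be a real separable Hilbert space (for instance $L^2[0,1]$), let $X$ be a random element of $\mathbb H$ with $\mathbb E\|X\|^4<\infty$, and let $X_1,X_2,\ldots$ be i.i.d. copies of $X$. Let $Q$ be a Borel probability measure on $\mathbb H$ that is symmetric (invariant under $f\mapsto -f$) and satisfies $\int_{\mathbb H}\|f\|^4\,Q(df)<\infty$. Write $\mu=\mathbb E X$, $\mathcal C f=\mathbb E(\langle X-\mu,f\rangle X)$, $\sigma_f^2=\langle \mathcal C f,f\rangle$, and, for $m\in\mathbb H$ and a positive trace-class operator $A$ on $\mathbb H$, $$\varphi(f;m,A)=\exp\left(i\langle m,f\rangle-\tfrac12\langle Af,f\rangle\right),\qquad f\in\mathbb H.$$ Let $\overline X_n=\frac1n\sum_{j=1}^nX_j$, $\mathcal C_nf=\frac1n\sum_{j=1}^n\langle X_j-\overline X_n,f\rangle(X_j-\overline X_n)$, and $$T_n=\int_{\mathbb H}\Big|\frac1n\sum_{j=1}^n e^{i\langle f,X_j\rangle}-\varphi(f;\overline X_n,\mathcal C_n)\Big|^2Q(df),\qquad \tau_Q=\int_{\mathbb H}\Big|\mathbb E\, e^{i\langle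 f,X\rangle}-\varphi(f;\mu,\mathcal C)\Big|^2Q(df).$$ With the centred element $Y=X-\mu$ (so $Y=X$ if $\mu=0$), put $$z(f)=\mathbb E\cos\langle f,Y\rangle+\mathbb E\sin\langle f,Y\rangle-e^{-\sigma_f^2/2},$$ $$\xi(f,x)=\cos\langle f,x\rangle-\mathbb E\cos\langle f,Y\rangle+\sin\langle f,x\rangle-\mathbb E\sin\langle f,Y\rangle+\langle f,x\rangle\,\mathbb E[\sin\langle f,Y\rangle-\cos\langle f,Y\rangle]+\tfrac12e^{-\sigma_f^2/2}\left(\langle f,x\rangle^2-\sigma_f^2\right),$$ $$K^\star(f,g)=\mathbb E[\xi(f,Y)\,\xi(g,Y)],\qquad \sigma^2=4\int_{\mathbb H}\int_{\mathbb H}K^\star(f,g)\,z(f)\,z(g)\,Q(df)\,Q(dg).$$ Then the integrals defining $K^\star$ and $\sigma^2$ converge absolutely, $\sigma^2\ge 0$, and, as $n\to\infty$, $$\sqrt n\,(T_n-\tau_Q)\ \xrightarrow{\ \mathcal D\ }\ \mathrm N(0,\sigma^2),$$ where $\mathrm N(0,0)$ is the point mass at $0$. -/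

import Mathlib

open MeasureTheory ProbabilityTheory Filter Topology
open scoped RealInnerProductSpace NNReal

noncomputable section

namespace GaussTest

variable {H : Type*} [NormedAddCommGroup H] [InnerProductSpace ℝ H]

/-- The functional `φ(f; μ, C) = exp (i⟨μ, f⟩ - ⟨C f, f⟩ / 2)`. -/
def gaussCharFun (m : H) (C : H → H) (f : H) : ℂ :=
  Complex.exp (Complex.I * (⟪m, f⟫ : ℝ) - (1 / 2 : ℂ) * (⟪C f, f⟫ : ℝ))

section Population

variable {Ω : Type*} [MeasurableSpace Ω]

/-- The expectation `E X` of a random element `X`, as a Bochner integral. -/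
def mean (X : Ω → H) (P : Measure Ω) : H := ∫ ω, X ω ∂P

/-- The covariance operator `C f = E (⟨X - E X, f⟩ X)`. -/
def covOp (X : Ω → H) (P : Measure Ω) (f : H) : H :=
  ∫ ω, ⟪X ω - mean X P, f⟫ • X ω ∂P

/-- `σ_f² = ⟨C f, f⟩`. -/
def sigmaSq (X : Ω → H) (P : Measure Ω) (f : H) : ℝ := ⟪covOp X P f, f⟫

/-- The characteristic functional `φ_X(f) = E exp (i⟨X, f⟩)`. -/
def charFunctional (X : Ω → H) (P : Measure Ω) (f : H) : ℂ :=
  ∫ ω, Complex.exp (Complex.I * (⟪X ω, f⟫ : ℝ)) ∂P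

/-- `τ_Q = ∫ |φ_X(f) - φ(f; E X, C)|² Q(df)`. -/
def tau [MeasurableSpace H] (Q : Measure H) (X : Ω → H) (P : Measure Ω) : ℝ :=
  ∫ f, ‖charFunctional X P f - gaussCharFun (mean X P) (covOp X P) f‖ ^ 2 ∂Q

/-- The centred random element `X - E X`. -/
def centred (X : Ω → H) (P : Measure Ω) (ω : Ω) : H := X ω - mean X P

/-- `z(f) = E cos⟨f, X⟩ + E sin⟨f, X⟩ - exp (-σ_f² / 2)`; meant for a centred `X`. -/
def zFun (X : Ω → H) (P : Measure Ω) (f : H) : ℝ :=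
  (∫ ω, Real.cos ⟪f, X ω⟫ ∂P) + (∫ ω, Real.sin ⟪f, X ω⟫ ∂P) - Real.exp (-(sigmaSq X P f) / 2)

/-- `ξ(f, x)`; meant for a centred `X`. -/
def xi (X : Ω → H) (P : Measure Ω) (f x : H) : ℝ :=
  Real.cos ⟪f, x⟫ - (∫ ω, Real.cos ⟪f, X ω⟫ ∂P)
    + Real.sin ⟪f, x⟫ - (∫ ω, Real.sin ⟪f, X ω⟫ ∂P)
    + ⟪f, x⟫ * (∫ ω, (Real.sin ⟪f, X ω⟫ - Real.cos ⟪f, X ω⟫) ∂P)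
    + 1 / 2 * Real.exp (-(sigmaSq X P f) / 2) * (⟪f, x⟫ ^ 2 - sigmaSq X P f)

/-- `K*(f, g) = E [ξ(f, X) ξ(g, X)]`; meant for a centred `X`. -/
def Kstar (X : Ω → H) (P : Measure Ω) (f g : H) : ℝ :=
  ∫ ω, xi X P f (X ω) * xi X P g (X ω) ∂P

end Population

section Sample

variable {n : ℕ}

/-- The sample mean. -/
def sampleMean (x : Fin n → H) : H := (n : ℝ)⁻¹ • ∑ j, x j

/-- The sample covariance operator `C_n f = n⁻¹ ∑ ⟨x_j - x̄, f⟩ (x_j - x̄)`. In `L²[0,1]` it is the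
integral operator with kernel `c_n(s,t) = n⁻¹ ∑ (x_j(s) - x̄(s)) (x_j(t) - x̄(t))`. -/
def sampleCovOp (x : Fin n → H) (f : H) : H :=
  (n : ℝ)⁻¹ • ∑ j, ⟪x j - sampleMean x, f⟫ • (x j - sampleMean x)

/-- The empirical characteristic functional `φ_n(f) = n⁻¹ ∑ exp (i⟨f, x_j⟩)`. -/
def empCharFunctional (x : Fin n → H) (f : H) : ℂ :=
  (n : ℂ)⁻¹ * ∑ j, Complex.exp (Complex.I * (⟪f, x j⟫ : ℝ))

/-- `T_n(x_1, …, x_n) = ∫ |φ_n(f) - φ(f; x̄, C_n)|² Q(df)`. -/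
def Tstat [MeasurableSpace H] (Q : Measure H) (x : Fin n → H) : ℝ :=
  ∫ f, ‖empCharFunctional x f - gaussCharFun (sampleMean x) (sampleCovOp x) f‖ ^ 2 ∂Q

end Sample

end GaussTest

end

/-! Both $T_n$ and $\tau_Q$ are squared $L^2(Q)$ norms of real functions. Factoring the unimodular
$e^{i\langle m,f\rangle}$ out of a difference of characteristic functionals removes the location and
leaves $(c-e^{-v/2})^2+s^2$, where $c,v$ are even and $s$ is odd in $f$. As $Q$ is symmetric, the
cross term $2(c-e^{-v/2})s$ integrates to zero, so the sum of squares may be replaced by the square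
of the single function $c+s-e^{-v/2}$ (`tau_eq_integral_sq`, `Tstat_eq_integral_sq`).

A deterministic expansion of the empirical $z_n$ about $z$ follows: $z_n-z$ is the average of
$\xi(f,Y_j)$ up to squares of averages of centred kernels (`abs_empirical_sub_linear_le`). Hence
$z_n^2-z^2$ is $2z$ times that average, with an error of the same kind (`abs_empZ_sq_sub_le`). By
independence, a squared average of centred kernels has mean $O(1/n)$, uniformly enough in $f$ to be
integrated against $Q$; fourth moments suffice because every kernel is at most quadratic in $\|f\|$
and in $\|y\|$.

Thus $\sqrt n(T_n-\tau_Q)$ is $n^{-1/2}\sum_j \psi(Y_j)$, with $\psi$ the function `influence`, plus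
a term of size $O(n^{-1/2})$ in $L^1$. The scalar central limit theorem and Slutsky's lemma give the
limit, and Fubini identifies the variance (`integral_influence_sq`). No limit theorem in function
space is needed. -/

set_option linter.unusedSectionVars false

namespace GaussTest

/-! ### Deterministic inequalities: Taylor remainders and averages of real numbers. -/

section Scalar

lemma abs_sin_sub_self_le_sq (x : ℝ) : |Real.sin x - x| ≤ x ^ 2 := by
  have key : ∀ y : ℝ, 0 < y → |Real.sin y - y| ≤ y ^ 2 := by
    intro y hy
    have h1 := Real.sin_lt hy
    rw [abs_of_neg (by linarith)]
    -- The cubic bound serves up to $1$. On $[1,3]$ the sine is nonnegative, so $y-\sin y\le y\le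
    -- y^2$; beyond $3$, $y+1\le y^2$.
    rcases le_total y 1 with h | h
    · have := Real.sin_gt_sub_cube hy
      nlinarith [pow_pos hy 2]
    · rcases le_total y 3 with h3 | h3
      · have := Real.sin_nonneg_of_nonneg_of_le_pi hy.le (by linarith [Real.pi_gt_three])
        nlinarith
      · have := Real.neg_one_le_sin y
        nlinarith
  rcases lt_trichotomy x 0 with h | h | h
  · have := key (-x) (by linarith)
    rw [Real.sin_neg, abs_sub_comm] at this
    rw [← neg_sq]
    convert this using 2
    ring
  · simp [h]
  · exact key x h

/-- The addition formulas make the remainder exactly $(\cos a+\sin a)(\cos m-1)+(\sin a-\cos a)(\sin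
m-m)$, whence $3=2\cdot\frac12+2\cdot1$. The bound holds for every $m$, so no smallness of the
sample mean is required. -/
lemma abs_cos_add_sin_sub_taylor_le (a m : ℝ) :
    |Real.cos (a - m) + Real.sin (a - m) - (Real.cos a + Real.sin a)
      - m * (Real.sin a - Real.cos a)| ≤ 3 * m ^ 2 := by
  have h : Real.cos (a - m) + Real.sin (a - m) - (Real.cos a + Real.sin a)
      - m * (Real.sin a - Real.cos a) =
      (Real.cos a + Real.sin a) * (Real.cos m - 1)
        + (Real.sin a - Real.cos a) * (Real.sin m - m) := by
    rw [Real.cos_sub, Real.sin_sub]; ring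
  have c1 : |Real.cos a + Real.sin a| ≤ 2 :=
    (abs_add_le _ _).trans (by linarith [Real.abs_cos_le_one a, Real.abs_sin_le_one a])
  have c2 : |Real.sin a - Real.cos a| ≤ 2 :=
    (abs_sub _ _).trans (by linarith [Real.abs_cos_le_one a, Real.abs_sin_le_one a])
  have c3 : |Real.cos m - 1| ≤ m ^ 2 / 2 := by
    rw [abs_le]
    constructor
    · linarith [Real.one_sub_sq_div_two_le_cos (x := m)]
    · linarith [Real.cos_le_one m, sq_nonneg m]
  rw [h]
  refine (abs_add_le _ _).trans ?_
  rw [abs_mul, abs_mul]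
  have := mul_le_mul c1 c3 (abs_nonneg _) (by norm_num)
  have := mul_le_mul c2 (abs_sin_sub_self_le_sq m) (abs_nonneg _) (by norm_num)
  linarith

lemma abs_exp_neg_sub_exp_neg_le {u w : ℝ} (hu : 0 ≤ u) (hw : 0 ≤ w) :
    |Real.exp (-u) - Real.exp (-w)| ≤ |u - w| := by
  have key : ∀ u w : ℝ, 0 ≤ u → u ≤ w → |Real.exp (-u) - Real.exp (-w)| ≤ |u - w| := by
    intro u w hu h
    have h1 : Real.exp (-w) ≤ Real.exp (-u) := Real.exp_le_exp.2 (by linarith)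
    rw [abs_of_nonneg (by linarith), abs_of_nonpos (by linarith)]
    have h2 : Real.exp (-w) = Real.exp (-u) * Real.exp (u - w) := by
      rw [← Real.exp_add]; ring_nf
    have h3 : Real.exp (-u) ≤ 1 := Real.exp_le_one_iff.2 (by linarith)
    have h4 := Real.add_one_le_exp (u - w)
    have h5 := Real.exp_pos (-u)
    nlinarith
  rcases le_total u w with h | h
  · exact key u w hu h
  · rw [abs_sub_comm, abs_sub_comm u]
    exact key w u hw h

/-- Convexity used twice: the tangent at $w$ makes the remainder nonnegative, the tangent at $u$
bounds it by $(u-w)(e^{-w}-e^{-u})$, and the Lipschitz bound finishes. -/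
lemma abs_exp_neg_taylor_le {u w : ℝ} (hu : 0 ≤ u) (hw : 0 ≤ w) :
    |Real.exp (-u) - Real.exp (-w) + Real.exp (-w) * (u - w)| ≤ (u - w) ^ 2 := by
  have hL := abs_exp_neg_sub_exp_neg_le hu hw
  have e1 : Real.exp (-u) = Real.exp (-w) * Real.exp (w - u) := by
    rw [← Real.exp_add]; ring_nf
  have e2 : Real.exp (-w) = Real.exp (-u) * Real.exp (u - w) := by
    rw [← Real.exp_add]; ring_nf
  have i1 := mul_le_mul_of_nonneg_left (Real.add_one_le_exp (w - u)) (Real.exp_pos (-w)).le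
  have i2 := mul_le_mul_of_nonneg_left (Real.add_one_le_exp (u - w)) (Real.exp_pos (-u)).le
  rw [← e1] at i1
  rw [← e2] at i2
  rw [abs_of_nonneg (by nlinarith)]
  have h3 : (u - w) * (Real.exp (-w) - Real.exp (-u)) ≤ |u - w| * |u - w| := by
    refine (le_abs_self _).trans ?_
    rw [abs_mul, abs_sub_comm (Real.exp (-w))]
    exact mul_le_mul_of_nonneg_left hL (abs_nonneg _)
  rw [abs_mul_abs_self] at h3
  nlinarith

variable {n : ℕ}

lemma abs_average_le (hn : 0 < n) (g : Fin n → ℝ) {B : ℝ} (h : ∀ j, |g j| ≤ B) :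
    |(n : ℝ)⁻¹ * ∑ j, g j| ≤ B := by
  have hn' : (0 : ℝ) < n := by exact_mod_cast hn
  rw [abs_mul, abs_of_pos (inv_pos.2 hn'), inv_mul_le_iff₀ hn']
  refine (Finset.abs_sum_le_sum_abs _ _).trans ((Finset.sum_le_sum fun j _ => h j).trans ?_)
  simp

lemma average_const (hn : 0 < n) (c : ℝ) : (n : ℝ)⁻¹ * ∑ _j : Fin n, c = c := by
  have hn' : (n : ℝ) ≠ 0 := by exact_mod_cast hn.ne'
  simp [hn']

lemma average_sub_sq (hn : 0 < n) (a : Fin n → ℝ) :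
    (n : ℝ)⁻¹ * ∑ j, (a j - (n : ℝ)⁻¹ * ∑ i, a i) ^ 2
      = (n : ℝ)⁻¹ * ∑ j, a j ^ 2 - ((n : ℝ)⁻¹ * ∑ i, a i) ^ 2 := by
  set m := (n : ℝ)⁻¹ * ∑ i, a i with hm
  have h1 : ∀ j, (a j - m) ^ 2 = a j ^ 2 - 2 * m * a j + m ^ 2 := fun j => by ring
  simp_rw [h1, Finset.sum_add_distrib, Finset.sum_sub_distrib, ← Finset.mul_sum]
  rw [mul_add, mul_sub, average_const hn]
  have : (n : ℝ)⁻¹ * (2 * m * ∑ i, a i) = 2 * m * m := by rw [hm]; ring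
  rw [this]; ring

/-- The remainder of the first-order expansion of the empirical version of `z`. -/
lemma abs_empirical_sub_linear_le (hn : 0 < n) (a : Fin n → ℝ) {c s v : ℝ} (hv : 0 ≤ v) :
    |((n : ℝ)⁻¹ * ∑ j, Real.cos (a j - (n : ℝ)⁻¹ * ∑ i, a i)
        + (n : ℝ)⁻¹ * ∑ j, Real.sin (a j - (n : ℝ)⁻¹ * ∑ i, a i)
        - Real.exp (-((n : ℝ)⁻¹ * ∑ j, (a j - (n : ℝ)⁻¹ * ∑ i, a i) ^ 2) / 2))
      - (c + s - Real.exp (-v / 2))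
      - (n : ℝ)⁻¹ * ∑ j, (Real.cos (a j) - c + Real.sin (a j) - s + a j * (s - c)
          + 1 / 2 * Real.exp (-v / 2) * (a j ^ 2 - v))|
      ≤ 4 * ((n : ℝ)⁻¹ * ∑ j, a j) ^ 2
        + ((n : ℝ)⁻¹ * ∑ j, (Real.sin (a j) - Real.cos (a j) - (s - c))) ^ 2
        + ((n : ℝ)⁻¹ * ∑ j, (a j ^ 2 - v)) ^ 2 := by
  rw [average_sub_sq hn]
  set m := (n : ℝ)⁻¹ * ∑ i, a i with hm
  set A := (n : ℝ)⁻¹ * ∑ j, (Real.cos (a j - m) + Real.sin (a j - m)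
    - (Real.cos (a j) + Real.sin (a j)) - m * (Real.sin (a j) - Real.cos (a j))) with hA
  set W := (n : ℝ)⁻¹ * ∑ j, (Real.sin (a j) - Real.cos (a j) - (s - c)) with hW
  set V := (n : ℝ)⁻¹ * ∑ j, (a j ^ 2 - v) with hV
  set q := (n : ℝ)⁻¹ * ∑ j, a j ^ 2 with hq
  have hqn : 0 ≤ q := mul_nonneg (by positivity) (Finset.sum_nonneg fun j _ => sq_nonneg _)
  have hVq : V = q - v := by
    rw [hV, Finset.sum_sub_distrib, mul_sub, average_const hn]
  have hm2 : m ^ 2 ≤ q := by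
    have := average_sub_sq hn a
    have h2 : 0 ≤ (n : ℝ)⁻¹ * ∑ j, (a j - (n : ℝ)⁻¹ * ∑ i, a i) ^ 2 :=
      mul_nonneg (by positivity) (Finset.sum_nonneg fun j _ => sq_nonneg _)
    rw [← hm, ← hq] at this
    rw [← hm] at h2
    linarith
  have hAb : |A| ≤ 3 * m ^ 2 := abs_average_le hn _ fun j => abs_cos_add_sin_sub_taylor_le _ _
  have hL : |Real.exp (-((q - m ^ 2) / 2)) - Real.exp (-(q / 2))| ≤ m ^ 2 / 2 := by
    refine (abs_exp_neg_sub_exp_neg_le (by linarith) (by linarith)).trans (le_of_eq ?_)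
    rw [← abs_neg, abs_of_nonneg (by nlinarith [sq_nonneg m])]; ring
  have hT : |Real.exp (-(q / 2)) - Real.exp (-(v / 2)) + Real.exp (-(v / 2)) * (q / 2 - v / 2)|
      ≤ V ^ 2 / 4 := by
    refine (abs_exp_neg_taylor_le (by linarith) (by linarith)).trans (le_of_eq ?_)
    rw [hVq]; ring
  have hmW : |m * W| ≤ m ^ 2 / 2 + W ^ 2 / 2 := by
    rw [abs_le]; constructor <;> nlinarith [sq_nonneg (m + W), sq_nonneg (m - W)]
  have e1 : -(q - m ^ 2) / 2 = -((q - m ^ 2) / 2) := by ring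
  have e2 : -v / 2 = -(v / 2) := by ring
  rw [e1, e2]
  -- The error has four sources: the Taylor remainder `A` of the shift by `m`; the product of `m`
  -- with the fluctuation `W` of the derivative; the loss of $m^2$ in the empirical variance; and
  -- the Taylor remainder of the exponential at `v`. The coefficient of $m^2$ adds up to
  -- $3+\frac12+\frac12=4$.
  have key : ((n : ℝ)⁻¹ * ∑ j, Real.cos (a j - m) + (n : ℝ)⁻¹ * ∑ j, Real.sin (a j - m)
        - Real.exp (-((q - m ^ 2) / 2)))
      - (c + s - Real.exp (-(v / 2)))
      - (n : ℝ)⁻¹ * ∑ j, (Real.cos (a j) - c + Real.sin (a j) - s + a j * (s - c)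
          + 1 / 2 * Real.exp (-(v / 2)) * (a j ^ 2 - v))
      = A + m * W
        - (Real.exp (-((q - m ^ 2) / 2)) - Real.exp (-(q / 2)))
        - (Real.exp (-(q / 2)) - Real.exp (-(v / 2)) + Real.exp (-(v / 2)) * (q / 2 - v / 2)) := by
    have hc := average_const hn c
    have hs := average_const hn s
    have hvv := average_const hn v
    have hsc := average_const hn (s - c)
    rw [hA, hW]
    simp only [Finset.sum_add_distrib, Finset.sum_sub_distrib, ← Finset.mul_sum,
      ← Finset.sum_mul, mul_add, mul_sub] at hc hs hvv hsc ⊢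
    rw [hc, hs]
    rw [mul_left_comm _ (1 / 2 * Real.exp (-(v / 2))), mul_left_comm _ (1 / 2 * Real.exp (-(v / 2))),
      hvv, ← hq, mul_left_comm _ m, mul_left_comm _ m, ← mul_assoc (n : ℝ)⁻¹ _ s,
      ← mul_assoc (n : ℝ)⁻¹ _ c, ← hm]
    ring
  rw [key]
  rw [abs_le] at *
  constructor <;> nlinarith [sq_nonneg m, sq_nonneg V, sq_nonneg W]

/-- The left side is $2z(Z-z-D)+(Z-z)^2$, and $(Z-z)^2\le D^2+2(Z-z)(Z-z-D)$; boundedness gives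
$18=2\cdot3+2\cdot6$. Only the first power of `B` appears: its square would demand moments beyond
the fourth. -/
lemma abs_sq_sub_sq_sub_linear_le {Z z D B : ℝ} (hZ : |Z| ≤ 3) (hz : |z| ≤ 3)
    (hB : |Z - z - D| ≤ B) : |Z ^ 2 - z ^ 2 - 2 * z * D| ≤ D ^ 2 + 18 * B := by
  have hzz : |Z - z| ≤ 6 := (abs_sub _ _).trans (by linarith)
  have h1 : |(Z - z) * (Z - z - D)| ≤ 6 * B := by
    rw [abs_mul]; exact mul_le_mul hzz hB (abs_nonneg _) (by norm_num)
  have h2 : |z * (Z - z - D)| ≤ 3 * B := by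
    rw [abs_mul]; exact mul_le_mul hz hB (abs_nonneg _) (by norm_num)
  have h3 : Z ^ 2 - z ^ 2 - 2 * z * D = 2 * (z * (Z - z - D)) + (Z - z) ^ 2 := by ring
  have h4 : (Z - z) ^ 2 ≤ D ^ 2 + 2 * ((Z - z) * (Z - z - D)) := by
    nlinarith [sq_nonneg (Z - z - D), sq_nonneg D]
  rw [h3]
  rw [abs_le] at *
  constructor <;> nlinarith [sq_nonneg (Z - z), sq_nonneg D]

end Scalar

/-! ### Second moments of averages of independent centred variables. -/

section EmpiricalMean

lemma aemeasurable_prod_comp_left {E F Ω : Type*} [MeasurableSpace E] [MeasurableSpace F]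
    [MeasurableSpace Ω] {P : Measure Ω} {Q : Measure F} {Y : ℕ → Ω → E}
    (hY : ∀ j, AEMeasurable (Y j) P) {h : F → E → ℝ}
    (hh : Measurable (Function.uncurry h)) (j : ℕ) :
    AEMeasurable (fun p : Ω × F => h p.2 (Y j p.1)) (P.prod Q) :=
  hh.comp_aemeasurable (f := fun p : Ω × F => (p.2, Y j p.1))
    (measurable_snd.aemeasurable.prodMk
      ((hY j).comp_quasiMeasurePreserving Measure.quasiMeasurePreserving_fst))

lemma aemeasurable_average_sq {E F Ω : Type*} [MeasurableSpace E] [MeasurableSpace F]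
    [MeasurableSpace Ω] {P : Measure Ω} {Q : Measure F} {Y : ℕ → Ω → E}
    (hY : ∀ j, AEMeasurable (Y j) P) {h : F → E → ℝ}
    (hh : Measurable (Function.uncurry h)) {n : ℕ} :
    AEMeasurable (fun p : Ω × F =>
      ENNReal.ofReal (((n : ℝ)⁻¹ * ∑ j : Fin n, h p.2 (Y j p.1)) ^ 2)) (P.prod Q) :=
  (((Finset.aemeasurable_fun_sum _ fun (j : Fin n) _ =>
    aemeasurable_prod_comp_left hY hh j).const_mul _).pow_const 2).ennreal_ofReal

variable {E : Type*} [MeasurableSpace E] {Ω : Type*} [MeasurableSpace Ω]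
  {P : Measure Ω} [IsProbabilityMeasure P] {ν : Measure E}
  {Y : ℕ → Ω → E}

/-- The second moment of the average of `n` independent copies of a centred variable. -/
lemma lintegral_average_sq_of_iIndepFun (hY : ∀ j, AEMeasurable (Y j) P)
    (hlaw : ∀ j, P.map (Y j) = ν) (hind : iIndepFun Y P) {g : E → ℝ} (hg : Measurable g)
    (hg2 : MemLp g 2 ν) (hg0 : ∫ y, g y ∂ν = 0) {n : ℕ} (hn : 0 < n) :
    ∫⁻ ω, ENNReal.ofReal (((n : ℝ)⁻¹ * ∑ j : Fin n, g (Y j ω)) ^ 2) ∂P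
      = ENNReal.ofReal ((n : ℝ)⁻¹ * ∫ y, g y ^ 2 ∂ν) := by
  have hgY : ∀ j, AEMeasurable (fun ω => g (Y j ω)) P := fun j => hg.comp_aemeasurable (hY j)
  have hmem : ∀ j, MemLp (fun ω => g (Y j ω)) 2 P := fun j => by
    have := (memLp_map_measure_iff (μ := P) (f := Y j) (g := g) (p := 2)
      hg.aestronglyMeasurable (hY j)).1 (by rw [hlaw j]; exact hg2)
    exact this
  have hmean : ∀ j, ∫ ω, g (Y j ω) ∂P = 0 := fun j => by
    rw [← integral_map (f := g) (hY j) hg.aestronglyMeasurable, hlaw j, hg0]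
  have hvar : ∀ j, Var[fun ω => g (Y j ω); P] = ∫ y, g y ^ 2 ∂ν := fun j => by
    rw [variance_of_integral_eq_zero (hgY j) (hmean j),
      ← integral_map (f := fun y => g y ^ 2) (hY j) (hg.pow_const 2).aestronglyMeasurable, hlaw j]
  set S : Ω → ℝ := fun ω => (n : ℝ)⁻¹ * ∑ j : Fin n, g (Y j ω) with hS
  have hsum : MemLp (fun ω => ∑ j : Fin n, g (Y j ω)) 2 P :=
    memLp_finsetSum _ fun j _ => hmem j
  have hSmem : MemLp S 2 P := hsum.const_mul _
  have hS0 : ∫ ω, S ω ∂P = 0 := by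
    rw [hS, integral_const_mul, integral_finsetSum _ fun (j : Fin n) _ =>
      (hmem j).integrable (by norm_num)]
    simp [hmean]
  have hSvar : Var[S; P] = (n : ℝ)⁻¹ * ∫ y, g y ^ 2 ∂ν := by
    rw [hS, variance_const_mul]
    have h1 : (fun ω => ∑ j : Fin n, g (Y j ω)) = ∑ j : Fin n, fun ω => g (Y j ω) := by
      ext ω; simp
    rw [h1, IndepFun.variance_sum (fun (j : Fin n) _ => hmem j)]
    · simp only [hvar, Finset.sum_const, Finset.card_univ, Fintype.card_fin, nsmul_eq_mul]
      have : (n : ℝ) ≠ 0 := by exact_mod_cast hn.ne'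
      field_simp
    · intro i _ j _ hij
      have hij' : (i : ℕ) ≠ j := fun h => hij (Fin.ext h)
      exact (hind.indepFun hij').comp hg hg
  rw [← hSvar, variance_of_integral_eq_zero hSmem.1.aemeasurable hS0,
    ofReal_integral_eq_lintegral_ofReal hSmem.integrable_sq (ae_of_all _ fun ω => sq_nonneg _)]

variable {F : Type*} [MeasurableSpace F] {Q : Measure F} [IsProbabilityMeasure Q]

/-- Average over `Q` of the second moment of the empirical means of a centred kernel. -/
lemma lintegral_prod_average_sq_le (hY : ∀ j, AEMeasurable (Y j) P)
    (hlaw : ∀ j, P.map (Y j) = ν) (hind : iIndepFun Y P) {h : F → E → ℝ}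
    (hh : Measurable (Function.uncurry h)) (hh0 : ∀ f, ∫ y, h f y ∂ν = 0)
    {b : F → ℝ} {B : E → ℝ} (hb : Integrable (fun f => b f ^ 2) Q) (hB : MemLp B 2 ν)
    (hbound : ∀ f y, |h f y| ≤ b f * B y) {n : ℕ} (hn : 0 < n) :
    ∫⁻ p : Ω × F, ENNReal.ofReal (((n : ℝ)⁻¹ * ∑ j : Fin n, h p.2 (Y j p.1)) ^ 2) ∂P.prod Q
      ≤ ENNReal.ofReal ((n : ℝ)⁻¹ * ((∫ f, b f ^ 2 ∂Q) * ∫ y, B y ^ 2 ∂ν)) := by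
  -- With the expectation inside, the variance formula applies for each fixed `f`.
  rw [lintegral_prod_symm _ (aemeasurable_average_sq hY hh)]
  have hsec : ∀ f, Measurable (h f) := fun f => hh.comp measurable_prodMk_left
  have hmem : ∀ f, MemLp (h f) 2 ν := fun f =>
    MemLp.of_le (hB.const_mul (b f)) (hsec f).aestronglyMeasurable (ae_of_all _ fun y =>
      (hbound f y).trans (le_abs_self _))
  have hn0 : (0 : ℝ) ≤ (n : ℝ)⁻¹ := by positivity
  have hpt : ∀ f, ∫⁻ ω, ENNReal.ofReal (((n : ℝ)⁻¹ * ∑ j : Fin n, h f (Y j ω)) ^ 2) ∂P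
      ≤ ENNReal.ofReal ((n : ℝ)⁻¹ * (b f ^ 2 * ∫ y, B y ^ 2 ∂ν)) := by
    intro f
    rw [lintegral_average_sq_of_iIndepFun hY hlaw hind (hsec f) (hmem f) (hh0 f) hn,
      ← integral_const_mul (b f ^ 2)]
    refine ENNReal.ofReal_le_ofReal (mul_le_mul_of_nonneg_left ?_ hn0)
    refine integral_mono (hmem f).integrable_sq (hB.integrable_sq.const_mul _) fun y => ?_
    simp only
    rw [← mul_pow, ← sq_abs (h f y)]
    exact pow_le_pow_left₀ (abs_nonneg _) (hbound f y) 2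
  refine (lintegral_mono hpt).trans (le_of_eq ?_)
  rw [← integral_mul_const, ← integral_const_mul,
    ofReal_integral_eq_lintegral_ofReal ((hb.mul_const _).const_mul _)]
  have hB0 : 0 ≤ ∫ y, B y ^ 2 ∂ν := integral_nonneg fun y => sq_nonneg _
  exact ae_of_all _ fun f => by positivity

end EmpiricalMean

/-! ### Symmetry of $Q$ and the removal of the location phase. -/

section Symmetrization

variable {H : Type*} [NormedAddCommGroup H] [MeasurableSpace H] [BorelSpace H]
  {Q : Measure H}

lemma integral_eq_zero_of_odd (hsymm : Q.map (fun f => -f) = Q) {g : H → ℝ}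
    (hodd : ∀ f, g (-f) = -g f) : ∫ f, g f ∂Q = 0 := by
  have h1 : ∫ f, g f ∂Q = ∫ f, g (-f) ∂Q := by
    conv_lhs => rw [← hsymm]
    exact integral_map_equiv (MeasurableEquiv.neg H) g
  simp_rw [hodd, integral_neg] at h1
  linarith

/-- Against a symmetric measure, an even and an odd function are orthogonal. -/
lemma integral_sq_add_sq_of_even_of_odd [IsProbabilityMeasure Q]
    (hsymm : Q.map (fun f => -f) = Q) {u s : H → ℝ} (hu : Measurable u) (hs : Measurable s)
    {K : ℝ} (huK : ∀ f, |u f| ≤ K) (hsK : ∀ f, |s f| ≤ K) (heven : ∀ f, u (-f) = u f)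
    (hodd : ∀ f, s (-f) = -s f) :
    ∫ f, (u f ^ 2 + s f ^ 2) ∂Q = ∫ f, (u f + s f) ^ 2 ∂Q := by
  have hum : MemLp u 2 Q := MemLp.of_bound hu.aestronglyMeasurable K (ae_of_all _ huK)
  have hsm : MemLp s 2 Q := MemLp.of_bound hs.aestronglyMeasurable K (ae_of_all _ hsK)
  have h0 : ∫ f, 2 * (u f * s f) ∂Q = 0 :=
    integral_eq_zero_of_odd hsymm fun f => by rw [heven, hodd]; ring
  have h1 : ∀ f, (u f + s f) ^ 2 = u f ^ 2 + s f ^ 2 + 2 * (u f * s f) := fun f => by ring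
  simp_rw [h1]
  have hi : Integrable (fun f => u f ^ 2 + s f ^ 2) Q := hum.integrable_sq.add hsm.integrable_sq
  have hj : Integrable (fun f => 2 * (u f * s f)) Q := (hum.integrable_mul hsm).const_mul 2
  rw [integral_add hi hj, h0, add_zero]

/-- Both terms carry the phase $e^{i\theta}$, which has modulus one. The same identity serves the
population and the sample. -/
lemma norm_exp_mul_sub_sq (θ c s v : ℝ) :
    ‖Complex.exp (Complex.I * θ) * (c + s * Complex.I)
      - Complex.exp (Complex.I * θ - (1 / 2 : ℂ) * v)‖ ^ 2
      = (c - Real.exp (-v / 2)) ^ 2 + s ^ 2 := by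
  have h1 : Complex.exp (Complex.I * θ - (1 / 2 : ℂ) * v)
      = Complex.exp (Complex.I * θ) * (Real.exp (-v / 2) : ℝ) := by
    rw [Complex.ofReal_exp, ← Complex.exp_add]
    congr 1; push_cast; ring
  have h2 : (c : ℂ) + s * Complex.I - (Real.exp (-v / 2) : ℝ)
      = ((c - Real.exp (-v / 2) : ℝ) : ℂ) + (s : ℝ) * Complex.I := by
    push_cast; ring
  rw [h1, ← mul_sub, norm_mul, mul_comm Complex.I, Complex.norm_exp_ofReal_mul_I, one_mul, h2,
    ← Complex.normSq_eq_norm_sq, Complex.normSq_add_mul_I]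

end Symmetrization

/-! ### Population functions of a centred law and their growth. -/

section Law

variable {H : Type*} [NormedAddCommGroup H] [InnerProductSpace ℝ H] [MeasurableSpace H]

/-- `∫ cos⟨f, y⟩ ν(dy)`. -/
noncomputable def cosMean (ν : Measure H) (f : H) : ℝ := ∫ y, Real.cos ⟪f, y⟫ ∂ν

/-- `∫ sin⟨f, y⟩ ν(dy)`. -/
noncomputable def sinMean (ν : Measure H) (f : H) : ℝ := ∫ y, Real.sin ⟪f, y⟫ ∂ν

/-- `∫ ⟨f, y⟩² ν(dy)`. -/
noncomputable def secondMoment (ν : Measure H) (f : H) : ℝ := ∫ y, ⟪f, y⟫ ^ 2 ∂ν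

/-- The function `z` of a centred law. -/
noncomputable def lawZ (ν : Measure H) (f : H) : ℝ :=
  cosMean ν f + sinMean ν f - Real.exp (-(secondMoment ν f) / 2)

/-- The kernel `ξ` of a centred law. -/
noncomputable def lawXi (ν : Measure H) (f y : H) : ℝ :=
  Real.cos ⟪f, y⟫ - cosMean ν f + Real.sin ⟪f, y⟫ - sinMean ν f
    + ⟪f, y⟫ * (sinMean ν f - cosMean ν f)
    + 1 / 2 * Real.exp (-(secondMoment ν f) / 2) * (⟪f, y⟫ ^ 2 - secondMoment ν f)

variable {ν : Measure H}

lemma secondMoment_nonneg (f : H) : 0 ≤ secondMoment ν f := integral_nonneg fun _ => sq_nonneg _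

lemma cosMean_neg (f : H) : cosMean ν (-f) = cosMean ν f := by simp [cosMean]

lemma sinMean_neg (f : H) : sinMean ν (-f) = -sinMean ν f := by
  simp [sinMean, integral_neg]

lemma secondMoment_neg (f : H) : secondMoment ν (-f) = secondMoment ν f := by
  simp [secondMoment]

lemma abs_integral_le_one_of_abs_le_one [IsProbabilityMeasure ν] {g : H → ℝ}
    (hg : ∀ y, |g y| ≤ 1) : |∫ y, g y ∂ν| ≤ 1 := by
  have := norm_integral_le_of_norm_le_const (μ := ν) (f := g) (C := 1) (ae_of_all _ hg)
  simpa using this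

lemma abs_cosMean_le [IsProbabilityMeasure ν] (f : H) : |cosMean ν f| ≤ 1 :=
  abs_integral_le_one_of_abs_le_one fun _ => Real.abs_cos_le_one _

lemma abs_sinMean_le [IsProbabilityMeasure ν] (f : H) : |sinMean ν f| ≤ 1 :=
  abs_integral_le_one_of_abs_le_one fun _ => Real.abs_sin_le_one _

lemma abs_add_sub_exp_le {c s v : ℝ} (hc : |c| ≤ 1) (hs : |s| ≤ 1) (hv : 0 ≤ v) :
    |c + s - Real.exp (-v / 2)| ≤ 3 := by
  have h1 : Real.exp (-v / 2) ≤ 1 := Real.exp_le_one_iff.2 (by linarith)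
  have h2 := Real.exp_pos (-v / 2)
  rw [abs_le] at *
  constructor <;> linarith

lemma abs_lawZ_le [IsProbabilityMeasure ν] (f : H) : |lawZ ν f| ≤ 3 :=
  abs_add_sub_exp_le (abs_cosMean_le f) (abs_sinMean_le f) (secondMoment_nonneg f)

variable [BorelSpace H] [SecondCountableTopology H]

lemma measurable_uncurry_inner : Measurable (Function.uncurry fun f y : H => ⟪f, y⟫) :=
  measurable_fst.inner measurable_snd

section

variable [SFinite ν]

lemma measurable_cosMean : Measurable (cosMean ν) :=
  (StronglyMeasurable.integral_prod_right (f := fun f y : H => Real.cos ⟪f, y⟫)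
    (Real.measurable_cos.comp measurable_uncurry_inner).stronglyMeasurable).measurable

lemma measurable_sinMean : Measurable (sinMean ν) :=
  (StronglyMeasurable.integral_prod_right (f := fun f y : H => Real.sin ⟪f, y⟫)
    (Real.measurable_sin.comp measurable_uncurry_inner).stronglyMeasurable).measurable

lemma measurable_secondMoment : Measurable (secondMoment ν) :=
  (StronglyMeasurable.integral_prod_right (f := fun f y : H => ⟪f, y⟫ ^ 2)
    (measurable_uncurry_inner.pow_const 2).stronglyMeasurable).measurable

lemma measurable_lawZ : Measurable (lawZ ν) :=
  (measurable_cosMean.add measurable_sinMean).sub (measurable_secondMoment.neg.div_const 2).exp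

/-- Stated for arbitrary arguments so that the sections, the swapped order and the triple product
below are all instances. -/
lemma measurable_lawXi_comp {α : Type*} [MeasurableSpace α] {u v : α → H} (hu : Measurable u)
    (hv : Measurable v) : Measurable fun a => lawXi ν (u a) (v a) := by
  have hi : Measurable fun a => ⟪u a, v a⟫ := hu.inner hv
  have hc : Measurable fun a => cosMean ν (u a) := measurable_cosMean.comp hu
  have hs : Measurable fun a => sinMean ν (u a) := measurable_sinMean.comp hu
  have hv : Measurable fun a => secondMoment ν (u a) := measurable_secondMoment.comp hu
  unfold lawXi
  fun_prop

lemma measurable_lawXi : Measurable (Function.uncurry (lawXi ν)) :=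
  measurable_lawXi_comp measurable_fst measurable_snd

lemma measurable_sin_sub_cos_sub : Measurable (Function.uncurry fun f y : H =>
    Real.sin ⟪f, y⟫ - Real.cos ⟪f, y⟫ - (sinMean ν f - cosMean ν f)) := by
  have hi : Measurable fun p : H × H => ⟪p.1, p.2⟫ := measurable_uncurry_inner
  have hc : Measurable fun p : H × H => cosMean ν p.1 := measurable_cosMean.comp measurable_fst
  have hs : Measurable fun p : H × H => sinMean ν p.1 := measurable_sinMean.comp measurable_fst
  unfold Function.uncurry
  fun_prop

lemma measurable_inner_sq_sub : Measurable (Function.uncurry fun f y : H =>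
    ⟪f, y⟫ ^ 2 - secondMoment ν f) :=
  (measurable_uncurry_inner.pow_const 2).sub (measurable_secondMoment.comp measurable_fst)

lemma measurable_lawXi_right (f : H) : Measurable (lawXi ν f) :=
  measurable_lawXi_comp measurable_const measurable_id

end

variable [IsProbabilityMeasure ν]

/-- From $(1+t^2)^2\le 2+2t^4$. This quadratic envelope is where the fourth moments enter, for the
law of $Y$ and for $Q$ alike. -/
lemma memLp_one_add_norm_sq (h4 : Integrable (fun y => ‖y‖ ^ 4) ν) :
    MemLp (fun y : H => 1 + ‖y‖ ^ 2) 2 ν := by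
  have hm : Measurable fun y : H => 1 + ‖y‖ ^ 2 := by fun_prop
  rw [memLp_two_iff_integrable_sq hm.aestronglyMeasurable]
  refine Integrable.mono' ((integrable_const (2 : ℝ)).add (h4.const_mul 2))
    (hm.pow_const 2).aestronglyMeasurable (ae_of_all _ fun y => ?_)
  rw [Real.norm_of_nonneg (by positivity), Pi.add_apply]
  nlinarith [sq_nonneg (‖y‖ ^ 2 - 1)]

lemma integrable_norm_sq_of_norm_pow_four (h4 : Integrable (fun y => ‖y‖ ^ 4) ν) :
    Integrable (fun y : H => ‖y‖ ^ 2) ν := by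
  refine ((memLp_one_add_norm_sq h4).integrable (by norm_num)).mono' (by fun_prop)
    (ae_of_all _ fun y => ?_)
  rw [Real.norm_of_nonneg (by positivity)]
  linarith

lemma integrable_of_norm_pow_four (h4 : Integrable (fun y => ‖y‖ ^ 4) ν) :
    Integrable (fun y : H => y) ν := by
  refine ((memLp_one_add_norm_sq h4).integrable (by norm_num)).mono' (by fun_prop)
    (ae_of_all _ fun y => ?_)
  nlinarith [sq_nonneg (‖y‖ - 1)]

lemma integrable_inner_of_norm_pow_four (h4 : Integrable (fun y => ‖y‖ ^ 4) ν) (f : H) :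
    Integrable (fun y => ⟪f, y⟫) ν := (integrable_of_norm_pow_four h4).const_inner f

lemma inner_sq_le (f y : H) : ⟪f, y⟫ ^ 2 ≤ ‖f‖ ^ 2 * ‖y‖ ^ 2 := by
  rw [← mul_pow, ← sq_abs]
  exact pow_le_pow_left₀ (abs_nonneg _) (abs_real_inner_le_norm f y) 2

lemma integrable_inner_sq (h4 : Integrable (fun y => ‖y‖ ^ 4) ν) (f : H) :
    Integrable (fun y => ⟪f, y⟫ ^ 2) ν := by
  refine ((integrable_norm_sq_of_norm_pow_four h4).const_mul (‖f‖ ^ 2)).mono' (by fun_prop)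
    (ae_of_all _ fun y => ?_)
  rw [Real.norm_of_nonneg (by positivity)]
  exact inner_sq_le f y

lemma secondMoment_le (h4 : Integrable (fun y => ‖y‖ ^ 4) ν) (f : H) :
    secondMoment ν f ≤ ‖f‖ ^ 2 * ∫ y, ‖y‖ ^ 2 ∂ν := by
  rw [← integral_const_mul]
  exact integral_mono (integrable_inner_sq h4 f)
    ((integrable_norm_sq_of_norm_pow_four h4).const_mul _) fun y => inner_sq_le f y

lemma integrable_cos_inner (f : H) : Integrable (fun y => Real.cos ⟪f, y⟫) ν :=
  Integrable.of_bound (by fun_prop) 1 (ae_of_all _ fun _ => Real.abs_cos_le_one _)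

lemma integrable_sin_inner (f : H) : Integrable (fun y => Real.sin ⟪f, y⟫) ν :=
  Integrable.of_bound (by fun_prop) 1 (ae_of_all _ fun _ => Real.abs_sin_le_one _)

lemma integral_inner_eq_zero [CompleteSpace H] (h4 : Integrable (fun y => ‖y‖ ^ 4) ν)
    (h0 : ∫ y, y ∂ν = 0) (f : H) :
    ∫ y, ⟪f, y⟫ ∂ν = 0 := by
  rw [integral_inner (integrable_of_norm_pow_four h4), h0, inner_zero_right]

lemma integral_sin_sub_cos_sub (f : H) :
    ∫ y, (Real.sin ⟪f, y⟫ - Real.cos ⟪f, y⟫ - (sinMean ν f - cosMean ν f)) ∂ν = 0 := by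
  have is := integrable_sin_inner (ν := ν) f
  have ic := integrable_cos_inner (ν := ν) f
  have isc : Integrable (fun y => Real.sin ⟪f, y⟫ - Real.cos ⟪f, y⟫) ν := is.sub ic
  rw [integral_sub isc (integrable_const _), integral_sub is ic]
  simp [sinMean, cosMean]

lemma integral_inner_sq_sub (h4 : Integrable (fun y => ‖y‖ ^ 4) ν) (f : H) :
    ∫ y, (⟪f, y⟫ ^ 2 - secondMoment ν f) ∂ν = 0 := by
  rw [integral_sub (integrable_inner_sq h4 f) (integrable_const _)]
  simp [secondMoment]

/-- The trigonometric and quadratic parts are centred by construction; the linear part needs the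
mean of `ν` to vanish. -/
lemma integral_lawXi [CompleteSpace H] (h4 : Integrable (fun y => ‖y‖ ^ 4) ν)
    (h0 : ∫ y, y ∂ν = 0) (f : H) :
    ∫ y, lawXi ν f y ∂ν = 0 := by
  have ic := integrable_cos_inner (ν := ν) f
  have is := integrable_sin_inner (ν := ν) f
  have ii := integrable_inner_of_norm_pow_four h4 f
  have iq := integrable_inner_sq h4 f
  unfold lawXi
  rw [integral_add, integral_const_mul, integral_inner_sq_sub h4, integral_add,
    integral_mul_const, integral_inner_eq_zero h4 h0, integral_sub, integral_add, integral_sub]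
  · simp [cosMean, sinMean]
  all_goals fun_prop

/-- The constant in the growth bound of the kernels. -/
noncomputable def growthConst (ν : Measure H) : ℝ := 5 + ∫ y, ‖y‖ ^ 2 ∂ν

lemma abs_inner_sq_sub_le (h4 : Integrable (fun y => ‖y‖ ^ 4) ν) (f y : H) :
    |⟪f, y⟫ ^ 2 - secondMoment ν f|
      ≤ ‖f‖ ^ 2 * ‖y‖ ^ 2 + ‖f‖ ^ 2 * ∫ y, ‖y‖ ^ 2 ∂ν := by
  have h1 := inner_sq_le f y
  have h2 := secondMoment_le h4 f
  have h3 := secondMoment_nonneg (ν := ν) f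
  rw [abs_le]
  constructor
  · nlinarith [sq_nonneg ⟪f, y⟫, sq_nonneg ‖f‖, sq_nonneg ‖y‖,
      mul_nonneg (sq_nonneg ‖f‖) (sq_nonneg ‖y‖)]
  · nlinarith [sq_nonneg ⟪f, y⟫]

/-- Gives all four kernels one product envelope, so that a single constant bounds all their second
moments. -/
lemma le_growthConst_mul {A D : ℝ} (f y : H)
    (h : A ≤ 5 + 2 * (‖f‖ ^ 2 * ‖y‖ ^ 2) + D) (hD : D ≤ ‖f‖ ^ 2 * ∫ y, ‖y‖ ^ 2 ∂ν) :
    A ≤ growthConst ν * (1 + ‖f‖ ^ 2) * (1 + ‖y‖ ^ 2) := by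
  have hm : 0 ≤ ∫ y, ‖y‖ ^ 2 ∂ν := integral_nonneg fun _ => by positivity
  unfold growthConst
  set M := ∫ y, ‖y‖ ^ 2 ∂ν
  have ha : 0 ≤ ‖f‖ ^ 2 := by positivity
  have hb : 0 ≤ ‖y‖ ^ 2 := by positivity
  generalize ‖f‖ ^ 2 = a at *
  generalize ‖y‖ ^ 2 = b at *
  nlinarith [mul_nonneg ha hb, mul_nonneg hm ha, mul_nonneg hm hb, mul_nonneg hm (mul_nonneg ha hb)]

lemma abs_inner_le_one_add (f y : H) : |⟪f, y⟫| ≤ (1 + ‖f‖ ^ 2 * ‖y‖ ^ 2) / 2 := by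
  have h := abs_real_inner_le_norm f y
  nlinarith [sq_nonneg (‖f‖ * ‖y‖ - 1)]

lemma abs_inner_le_growth (f y : H) :
    |⟪f, y⟫| ≤ growthConst ν * (1 + ‖f‖ ^ 2) * (1 + ‖y‖ ^ 2) := by
  have h1 : 0 ≤ ‖f‖ ^ 2 * ‖y‖ ^ 2 := by positivity
  have h2 : 0 ≤ ‖f‖ ^ 2 * ∫ y, ‖y‖ ^ 2 ∂ν :=
    mul_nonneg (by positivity) (integral_nonneg fun _ => by positivity)
  exact le_growthConst_mul f y (D := 0) (by linarith [abs_inner_le_one_add f y]) h2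

lemma abs_sin_sub_cos_sub_le_growth (f y : H) :
    |Real.sin ⟪f, y⟫ - Real.cos ⟪f, y⟫ - (sinMean ν f - cosMean ν f)|
      ≤ growthConst ν * (1 + ‖f‖ ^ 2) * (1 + ‖y‖ ^ 2) := by
  have h1 : 0 ≤ ‖f‖ ^ 2 * ‖y‖ ^ 2 := by positivity
  have h2 : 0 ≤ ‖f‖ ^ 2 * ∫ y, ‖y‖ ^ 2 ∂ν :=
    mul_nonneg (by positivity) (integral_nonneg fun _ => by positivity)
  refine le_growthConst_mul f y (D := 0) ?_ h2
  have c1 := abs_le.1 (abs_cosMean_le (ν := ν) f)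
  have c2 := abs_le.1 (abs_sinMean_le (ν := ν) f)
  have c3 := abs_le.1 (Real.abs_cos_le_one ⟪f, y⟫)
  have c4 := abs_le.1 (Real.abs_sin_le_one ⟪f, y⟫)
  rw [abs_le]
  constructor <;> linarith

lemma abs_inner_sq_sub_le_growth (h4 : Integrable (fun y => ‖y‖ ^ 4) ν) (f y : H) :
    |⟪f, y⟫ ^ 2 - secondMoment ν f| ≤ growthConst ν * (1 + ‖f‖ ^ 2) * (1 + ‖y‖ ^ 2) := by
  have h1 : 0 ≤ ‖f‖ ^ 2 * ‖y‖ ^ 2 := by positivity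
  exact le_growthConst_mul f y (by linarith [abs_inner_sq_sub_le h4 f y]) le_rfl

/-- The four trigonometric terms contribute $4$, the linear term at most $1+\|f\|^2\|y\|^2$, and the
quadratic term half of its own bound; this explains the $5$ in `growthConst`. -/
lemma abs_lawXi_le_growth (h4 : Integrable (fun y => ‖y‖ ^ 4) ν) (f y : H) :
    |lawXi ν f y| ≤ growthConst ν * (1 + ‖f‖ ^ 2) * (1 + ‖y‖ ^ 2) := by
  have h1 : 0 ≤ ‖f‖ ^ 2 * ‖y‖ ^ 2 := by positivity
  have h2 : 0 ≤ ‖f‖ ^ 2 * ∫ y, ‖y‖ ^ 2 ∂ν :=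
    mul_nonneg (by positivity) (integral_nonneg fun _ => by positivity)
  refine le_growthConst_mul f y ?_ le_rfl
  have c1 := abs_le.1 (abs_cosMean_le (ν := ν) f)
  have c2 := abs_le.1 (abs_sinMean_le (ν := ν) f)
  have c3 := abs_le.1 (Real.abs_cos_le_one ⟪f, y⟫)
  have c4 := abs_le.1 (Real.abs_sin_le_one ⟪f, y⟫)
  have e1 : Real.exp (-(secondMoment ν f) / 2) ≤ 1 :=
    Real.exp_le_one_iff.2 (by linarith [secondMoment_nonneg (ν := ν) f])
  have e2 := (Real.exp_pos (-(secondMoment ν f) / 2)).le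
  have hq : |1 / 2 * Real.exp (-(secondMoment ν f) / 2) * (⟪f, y⟫ ^ 2 - secondMoment ν f)|
      ≤ 1 / 2 * (‖f‖ ^ 2 * ‖y‖ ^ 2 + ‖f‖ ^ 2 * ∫ y, ‖y‖ ^ 2 ∂ν) := by
    rw [abs_mul, abs_of_nonneg (by positivity : 0 ≤ 1 / 2 * Real.exp (-(secondMoment ν f) / 2))]
    exact mul_le_mul (by linarith) (abs_inner_sq_sub_le h4 f y) (abs_nonneg _) (by norm_num)
  have hl : |⟪f, y⟫ * (sinMean ν f - cosMean ν f)| ≤ 1 + ‖f‖ ^ 2 * ‖y‖ ^ 2 := by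
    have h3 : |sinMean ν f - cosMean ν f| ≤ 2 := abs_le.2 ⟨by linarith, by linarith⟩
    rw [abs_mul]
    have := mul_le_mul (abs_inner_le_one_add f y) h3 (abs_nonneg _) (by linarith)
    linarith
  have hl' := abs_le.1 hl
  have hq' := abs_le.1 hq
  unfold lawXi
  rw [abs_le]
  constructor <;> linarith

end Law

/-! ### Population quantities in terms of the law of $X-\mu$. -/

section Population

variable {H : Type*} [NormedAddCommGroup H] [InnerProductSpace ℝ H] [CompleteSpace H]
  [SecondCountableTopology H] [MeasurableSpace H] [BorelSpace H]
  {Ω₀ : Type*} [MeasurableSpace Ω₀] {P₀ : Measure Ω₀} [IsProbabilityMeasure P₀] {X : Ω₀ → H}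

/-- The law of the centred random element. -/
noncomputable def centredLaw (X : Ω₀ → H) (P₀ : Measure Ω₀) : Measure H := P₀.map (centred X P₀)

lemma aemeasurable_centred (hXm : AEMeasurable X P₀) : AEMeasurable (centred X P₀) P₀ :=
  hXm.sub_const _

lemma integral_comp_centred (hXm : AEMeasurable X P₀) {G : Type*} [NormedAddCommGroup G]
    [NormedSpace ℝ G] [SecondCountableTopology G] [MeasurableSpace G] [BorelSpace G] {g : H → G}
    (hg : Measurable g) :
    ∫ ω, g (centred X P₀ ω) ∂P₀ = ∫ y, g y ∂centredLaw X P₀ :=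
  (integral_map (aemeasurable_centred hXm) hg.stronglyMeasurable.aestronglyMeasurable).symm

lemma norm_sub_pow_four_le (x m : H) : ‖x - m‖ ^ 4 ≤ 8 * (‖x‖ ^ 4 + ‖m‖ ^ 4) := by
  have h1 : ‖x - m‖ ^ 4 ≤ (‖x‖ + ‖m‖) ^ 4 := pow_le_pow_left₀ (norm_nonneg _) (norm_sub_le x m) 4
  nlinarith [sq_nonneg (‖x‖ ^ 2 - ‖m‖ ^ 2), sq_nonneg (‖x‖ - ‖m‖),
    mul_nonneg (sq_nonneg (‖x‖ - ‖m‖)) (sq_nonneg ‖x‖),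
    mul_nonneg (sq_nonneg (‖x‖ - ‖m‖)) (sq_nonneg ‖m‖),
    mul_nonneg (sq_nonneg (‖x‖ - ‖m‖)) (sq_nonneg (‖x‖ + ‖m‖))]

lemma integrable_centred_pow_four (hXm : AEMeasurable X P₀)
    (hX : Integrable (fun ω => ‖X ω‖ ^ 4) P₀) :
    Integrable (fun ω => ‖centred X P₀ ω‖ ^ 4) P₀ := by
  refine ((hX.add (integrable_const (‖mean X P₀‖ ^ 4))).const_mul 8).mono'
    ((aemeasurable_centred hXm).norm.pow_const 4).aestronglyMeasurable (ae_of_all _ fun ω => ?_)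
  rw [Real.norm_of_nonneg (by positivity)]
  exact norm_sub_pow_four_le _ _

lemma integrable_centredLaw_pow_four (hXm : AEMeasurable X P₀)
    (hX : Integrable (fun ω => ‖X ω‖ ^ 4) P₀) :
    Integrable (fun y => ‖y‖ ^ 4) (centredLaw X P₀) :=
  (integrable_map_measure (by fun_prop) (aemeasurable_centred hXm)).2
    (integrable_centred_pow_four hXm hX)

lemma isProbabilityMeasure_centredLaw (hXm : AEMeasurable X P₀) :
    IsProbabilityMeasure (centredLaw X P₀) :=
  Measure.isProbabilityMeasure_map (aemeasurable_centred hXm)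

lemma integrable_centred (hXm : AEMeasurable X P₀) (hX : Integrable (fun ω => ‖X ω‖ ^ 4) P₀) :
    Integrable (centred X P₀) P₀ := by
  have := isProbabilityMeasure_centredLaw hXm
  have h := integrable_of_norm_pow_four (integrable_centredLaw_pow_four hXm hX)
  exact (integrable_map_measure (g := fun y : H => y) (by fun_prop) (aemeasurable_centred hXm)).1 h

lemma integrable_of_centred (hXm : AEMeasurable X P₀)
    (hX : Integrable (fun ω => ‖X ω‖ ^ 4) P₀) : Integrable X P₀ := by
  have h := (integrable_centred hXm hX).add (integrable_const (mean X P₀))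
  refine h.congr (ae_of_all _ fun ω => ?_)
  simp [centred]

lemma mean_centred (hXm : AEMeasurable X P₀) (hX : Integrable (fun ω => ‖X ω‖ ^ 4) P₀) :
    mean (centred X P₀) P₀ = 0 := by
  unfold mean centred
  rw [integral_sub (integrable_of_centred hXm hX) (integrable_const _)]
  simp [mean]

lemma integral_centredLaw (hXm : AEMeasurable X P₀) (hX : Integrable (fun ω => ‖X ω‖ ^ 4) P₀) :
    ∫ y, y ∂centredLaw X P₀ = 0 := by
  rw [← integral_comp_centred hXm (g := fun y : H => y) measurable_id]
  exact mean_centred hXm hX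

lemma cosMean_centredLaw (hXm : AEMeasurable X P₀) (f : H) :
    cosMean (centredLaw X P₀) f = ∫ ω, Real.cos ⟪f, centred X P₀ ω⟫ ∂P₀ :=
  (integral_comp_centred hXm (by fun_prop)).symm

lemma sinMean_centredLaw (hXm : AEMeasurable X P₀) (f : H) :
    sinMean (centredLaw X P₀) f = ∫ ω, Real.sin ⟪f, centred X P₀ ω⟫ ∂P₀ :=
  (integral_comp_centred hXm (by fun_prop)).symm

lemma secondMoment_centredLaw (hXm : AEMeasurable X P₀) (f : H) :
    secondMoment (centredLaw X P₀) f = ∫ ω, ⟪f, centred X P₀ ω⟫ ^ 2 ∂P₀ :=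
  (integral_comp_centred hXm (by fun_prop)).symm

lemma memLp_centred_two (hXm : AEMeasurable X P₀) (hX : Integrable (fun ω => ‖X ω‖ ^ 4) P₀) :
    MemLp (centred X P₀) 2 P₀ := by
  have := isProbabilityMeasure_centredLaw hXm
  have h := integrable_norm_sq_of_norm_pow_four (integrable_centredLaw_pow_four hXm hX)
  rw [memLp_two_iff_integrable_sq_norm (aemeasurable_centred hXm).aestronglyMeasurable]
  exact (integrable_map_measure (by fun_prop) (aemeasurable_centred hXm)).1 h

/-- The shift `c` contributes $\langle f,c\rangle\,\mathbb E\langle f,Y\rangle=0$. Since `covOp`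
centres only one factor, $c=\mu$ yields the operator of $X$, and $c=0$ that of $Y$. -/
lemma sigmaSq_eq_secondMoment (hXm : AEMeasurable X P₀)
    (hX : Integrable (fun ω => ‖X ω‖ ^ 4) P₀) (c f : H) :
    ⟪∫ ω, ⟪centred X P₀ ω, f⟫ • (centred X P₀ ω + c) ∂P₀, f⟫
      = secondMoment (centredLaw X P₀) f := by
  have hm := memLp_centred_two hXm hX
  have hi : MemLp (fun ω => ⟪centred X P₀ ω, f⟫) 2 P₀ := hm.inner_const f
  have hint : Integrable (fun ω => ⟪centred X P₀ ω, f⟫ • (centred X P₀ ω + c)) P₀ :=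
    memLp_one_iff_integrable.1 (MemLp.smul (hm.add (memLp_const c)) hi)
  rw [real_inner_comm, ← integral_inner hint, secondMoment_centredLaw hXm]
  have h0 : ∫ ω, ⟪f, centred X P₀ ω⟫ ∂P₀ = 0 := by
    rw [integral_inner (integrable_centred hXm hX)]
    have := mean_centred hXm hX
    unfold mean at this
    rw [this, inner_zero_right]
  have h1 : ∀ ω, ⟪f, ⟪centred X P₀ ω, f⟫ • (centred X P₀ ω + c)⟫
      = ⟪f, centred X P₀ ω⟫ ^ 2 + ⟪f, c⟫ * ⟪f, centred X P₀ ω⟫ := fun ω => by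
    rw [inner_smul_right, inner_add_right, real_inner_comm f]; ring
  simp_rw [h1]
  have hi' : MemLp (fun ω => ⟪f, centred X P₀ ω⟫) 2 P₀ := hm.const_inner f
  rw [integral_add hi'.integrable_sq ((hi'.integrable (by norm_num)).const_mul _),
    integral_const_mul, h0, mul_zero, add_zero]

lemma sigmaSq_centred (hXm : AEMeasurable X P₀) (hX : Integrable (fun ω => ‖X ω‖ ^ 4) P₀) (f : H) :
    sigmaSq (centred X P₀) P₀ f = secondMoment (centredLaw X P₀) f := by
  rw [← sigmaSq_eq_secondMoment hXm hX 0 f]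
  unfold sigmaSq covOp
  simp [mean_centred hXm hX]

lemma sigmaSq_eq (hXm : AEMeasurable X P₀) (hX : Integrable (fun ω => ‖X ω‖ ^ 4) P₀) (f : H) :
    sigmaSq X P₀ f = secondMoment (centredLaw X P₀) f := by
  rw [← sigmaSq_eq_secondMoment hXm hX (mean X P₀) f]
  unfold sigmaSq covOp
  simp [centred]

lemma zFun_centred (hXm : AEMeasurable X P₀) (hX : Integrable (fun ω => ‖X ω‖ ^ 4) P₀) (f : H) :
    zFun (centred X P₀) P₀ f = lawZ (centredLaw X P₀) f := by
  unfold zFun lawZ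
  rw [sigmaSq_centred hXm hX, cosMean_centredLaw hXm, sinMean_centredLaw hXm]

lemma xi_centred (hXm : AEMeasurable X P₀) (hX : Integrable (fun ω => ‖X ω‖ ^ 4) P₀) (f y : H) :
    xi (centred X P₀) P₀ f y = lawXi (centredLaw X P₀) f y := by
  unfold xi lawXi
  have hc := aemeasurable_centred hXm
  have h1 : Integrable (fun ω => Real.cos ⟪f, centred X P₀ ω⟫) P₀ :=
    Integrable.of_bound (by fun_prop) 1 (ae_of_all _ fun _ => Real.abs_cos_le_one _)
  have h2 : Integrable (fun ω => Real.sin ⟪f, centred X P₀ ω⟫) P₀ :=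
    Integrable.of_bound (by fun_prop) 1 (ae_of_all _ fun _ => Real.abs_sin_le_one _)
  rw [sigmaSq_centred hXm hX, cosMean_centredLaw hXm, sinMean_centredLaw hXm, integral_sub h2 h1]

lemma Kstar_centred (hXm : AEMeasurable X P₀) (hX : Integrable (fun ω => ‖X ω‖ ^ 4) P₀)
    (f g : H) : Kstar (centred X P₀) P₀ f g
      = ∫ y, lawXi (centredLaw X P₀) f y * lawXi (centredLaw X P₀) g y ∂centredLaw X P₀ := by
  have := isProbabilityMeasure_centredLaw hXm
  unfold Kstar
  simp_rw [xi_centred hXm hX]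
  exact integral_comp_centred hXm
    (g := fun y => lawXi (centredLaw X P₀) f y * lawXi (centredLaw X P₀) g y)
    ((measurable_lawXi_right f).mul (measurable_lawXi_right g))

lemma charFunctional_eq (hXm : AEMeasurable X P₀) (f : H) :
    charFunctional X P₀ f = Complex.exp (Complex.I * (⟪mean X P₀, f⟫ : ℝ))
      * ((cosMean (centredLaw X P₀) f : ℝ) + (sinMean (centredLaw X P₀) f : ℝ) * Complex.I) := by
  have hc := aemeasurable_centred hXm
  have h1 : Integrable (fun ω => Real.cos ⟪f, centred X P₀ ω⟫) P₀ :=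
    Integrable.of_bound (by fun_prop) 1 (ae_of_all _ fun _ => Real.abs_cos_le_one _)
  have h2 : Integrable (fun ω => Real.sin ⟪f, centred X P₀ ω⟫) P₀ :=
    Integrable.of_bound (by fun_prop) 1 (ae_of_all _ fun _ => Real.abs_sin_le_one _)
  rw [cosMean_centredLaw hXm, sinMean_centredLaw hXm, ← integral_complex_ofReal,
    ← integral_complex_ofReal, ← integral_mul_const, ← integral_add h1.ofReal (h2.ofReal.mul_const _),
    ← integral_const_mul]
  unfold charFunctional
  congr 1
  ext ω
  have h3 : X ω = mean X P₀ + centred X P₀ ω := by simp [centred]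
  rw [h3, inner_add_left, real_inner_comm f (centred X P₀ ω)]
  push_cast
  rw [mul_add, Complex.exp_add, mul_comm Complex.I ((⟪f, centred X P₀ ω⟫ : ℝ) : ℂ),
    Complex.exp_mul_I]

/-- `τ_Q` as the integral of the square of `z`. -/
lemma tau_eq_integral_sq {Q : Measure H} [IsProbabilityMeasure Q]
    (hsymm : Q.map (fun f => -f) = Q) (hXm : AEMeasurable X P₀)
    (hX : Integrable (fun ω => ‖X ω‖ ^ 4) P₀) :
    tau Q X P₀ = ∫ f, lawZ (centredLaw X P₀) f ^ 2 ∂Q := by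
  have := isProbabilityMeasure_centredLaw hXm
  set ν := centredLaw X P₀ with hν
  have h1 : ∀ f, ‖charFunctional X P₀ f - gaussCharFun (mean X P₀) (covOp X P₀) f‖ ^ 2
      = (cosMean ν f - Real.exp (-(secondMoment ν f) / 2)) ^ 2 + sinMean ν f ^ 2 := by
    intro f
    have h2 := sigmaSq_eq hXm hX f
    unfold sigmaSq at h2
    rw [charFunctional_eq hXm, gaussCharFun, h2, norm_exp_mul_sub_sq]
  unfold tau
  simp_rw [h1]
  have hu : Measurable fun f => cosMean ν f - Real.exp (-(secondMoment ν f) / 2) :=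
    measurable_cosMean.sub (measurable_secondMoment.neg.div_const 2).exp
  -- The cosine and Gaussian parts are even in `f`, the sine part is odd.
  rw [integral_sq_add_sq_of_even_of_odd hsymm (K := 2) hu measurable_sinMean]
  · congr 1; ext f; unfold lawZ; ring
  · intro f
    have e1 : Real.exp (-(secondMoment ν f) / 2) ≤ 1 :=
      Real.exp_le_one_iff.2 (by linarith [secondMoment_nonneg (ν := ν) f])
    have e2 := (Real.exp_pos (-(secondMoment ν f) / 2)).le
    have := abs_le.1 (abs_cosMean_le (ν := ν) f)
    rw [abs_le]; constructor <;> linarith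
  · intro f; linarith [abs_sinMean_le (ν := ν) f]
  · intro f; simp only [cosMean_neg, secondMoment_neg]
  · exact sinMean_neg

end Population

/-! ### The statistic in terms of the empirical $z$. -/

section Sample

variable {H : Type*} [NormedAddCommGroup H] [InnerProductSpace ℝ H] {n : ℕ}

/-- The empirical version of `z`. -/
noncomputable def empZ (x : Fin n → H) (f : H) : ℝ :=
  (n : ℝ)⁻¹ * ∑ j, Real.cos ⟪f, x j - sampleMean x⟫
    + (n : ℝ)⁻¹ * ∑ j, Real.sin ⟪f, x j - sampleMean x⟫
    - Real.exp (-((n : ℝ)⁻¹ * ∑ j, ⟪f, x j - sampleMean x⟫ ^ 2) / 2)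

lemma empCharFunctional_eq (x : Fin n → H) (f : H) :
    empCharFunctional x f = Complex.exp (Complex.I * (⟪sampleMean x, f⟫ : ℝ))
      * ((((n : ℝ)⁻¹ * ∑ j, Real.cos ⟪f, x j - sampleMean x⟫ : ℝ) : ℂ)
        + (((n : ℝ)⁻¹ * ∑ j, Real.sin ⟪f, x j - sampleMean x⟫ : ℝ) : ℂ) * Complex.I) := by
  unfold empCharFunctional
  have h : ∀ j, Complex.exp (Complex.I * (⟪f, x j⟫ : ℝ))
      = Complex.exp (Complex.I * (⟪sampleMean x, f⟫ : ℝ))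
        * ((Real.cos ⟪f, x j - sampleMean x⟫ : ℝ)
          + (Real.sin ⟪f, x j - sampleMean x⟫ : ℝ) * Complex.I) := by
    intro j
    have h1 : ⟪f, x j⟫ = ⟪sampleMean x, f⟫ + ⟪f, x j - sampleMean x⟫ := by
      rw [inner_sub_right, real_inner_comm f]; ring
    rw [h1]
    push_cast
    rw [mul_add, Complex.exp_add,
      mul_comm Complex.I ((⟪f, x j - sampleMean x⟫ : ℝ) : ℂ), Complex.exp_mul_I]
  simp_rw [h]
  push_cast
  rw [← Finset.mul_sum, Finset.sum_add_distrib, ← Finset.sum_mul]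
  ring

lemma inner_sampleCovOp (x : Fin n → H) (f : H) :
    ⟪sampleCovOp x f, f⟫ = (n : ℝ)⁻¹ * ∑ j, ⟪f, x j - sampleMean x⟫ ^ 2 := by
  unfold sampleCovOp
  rw [real_inner_smul_left, sum_inner]
  congr 1
  refine Finset.sum_congr rfl fun j _ => ?_
  rw [real_inner_smul_left, real_inner_comm f]; ring

lemma continuous_empZ_uncurry :
    Continuous (Function.uncurry fun (x : Fin n → H) (f : H) => empZ x f) := by
  unfold empZ sampleMean Function.uncurry
  fun_prop

lemma abs_empZ_le (hn : 0 < n) (x : Fin n → H) (f : H) : |empZ x f| ≤ 3 :=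
  abs_add_sub_exp_le (abs_average_le hn _ fun _ => Real.abs_cos_le_one _)
    (abs_average_le hn _ fun _ => Real.abs_sin_le_one _)
    (mul_nonneg (by positivity) (Finset.sum_nonneg fun _ _ => sq_nonneg _))

variable [SecondCountableTopology H] [MeasurableSpace H] [BorelSpace H]

/-- `T_n` as the integral of the square of the empirical version of `z`. -/
lemma Tstat_eq_integral_sq {Q : Measure H} [IsProbabilityMeasure Q]
    (hsymm : Q.map (fun f => -f) = Q) (hn : 0 < n) (x : Fin n → H) :
    Tstat Q x = ∫ f, empZ x f ^ 2 ∂Q := by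
  have h1 : ∀ f, ‖empCharFunctional x f - gaussCharFun (sampleMean x) (sampleCovOp x) f‖ ^ 2
      = ((n : ℝ)⁻¹ * ∑ j, Real.cos ⟪f, x j - sampleMean x⟫
          - Real.exp (-((n : ℝ)⁻¹ * ∑ j, ⟪f, x j - sampleMean x⟫ ^ 2) / 2)) ^ 2
        + ((n : ℝ)⁻¹ * ∑ j, Real.sin ⟪f, x j - sampleMean x⟫) ^ 2 := by
    intro f
    rw [empCharFunctional_eq, gaussCharFun, inner_sampleCovOp, norm_exp_mul_sub_sq]
  unfold Tstat
  simp_rw [h1]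
  rw [integral_sq_add_sq_of_even_of_odd hsymm (K := 2) (by fun_prop) (by fun_prop)]
  · congr 1; ext f; unfold empZ; ring
  · intro f
    have e0 : 0 ≤ (n : ℝ)⁻¹ * ∑ j, ⟪f, x j - sampleMean x⟫ ^ 2 :=
      mul_nonneg (by positivity) (Finset.sum_nonneg fun _ _ => sq_nonneg _)
    have e1 : Real.exp (-((n : ℝ)⁻¹ * ∑ j, ⟪f, x j - sampleMean x⟫ ^ 2) / 2) ≤ 1 :=
      Real.exp_le_one_iff.2 (by linarith)
    have e2 := (Real.exp_pos (-((n : ℝ)⁻¹ * ∑ j, ⟪f, x j - sampleMean x⟫ ^ 2) / 2)).le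
    have := abs_le.1 (abs_average_le hn (fun j => Real.cos ⟪f, x j - sampleMean x⟫)
      fun _ => Real.abs_cos_le_one _)
    rw [abs_le]; constructor <;> linarith
  · intro f
    exact (abs_average_le hn _ fun _ => Real.abs_sin_le_one _).trans (by norm_num)
  · intro f; simp only [inner_neg_left, Real.cos_neg, neg_sq]
  · intro f; simp only [inner_neg_left, Real.sin_neg, Finset.sum_neg_distrib, mul_neg]

lemma measurable_Tstat {Q : Measure H} [SFinite Q] :
    Measurable (fun x : Fin n → H => Tstat Q x) := by
  unfold Tstat
  refine (StronglyMeasurable.integral_prod_right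
    (f := fun (x : Fin n → H) (f : H) =>
      ‖empCharFunctional x f - gaussCharFun (sampleMean x) (sampleCovOp x) f‖ ^ 2)
    (Continuous.measurable ?_).stronglyMeasurable).measurable
  unfold empCharFunctional gaussCharFun sampleCovOp sampleMean Function.uncurry
  fun_prop

end Sample

/-! ### The linear term and the asymptotic variance. -/

section Influence

variable {H : Type*} [NormedAddCommGroup H] [InnerProductSpace ℝ H]
  [SecondCountableTopology H] [MeasurableSpace H] [BorelSpace H]
  {ν Q : Measure H} [IsProbabilityMeasure ν] [IsProbabilityMeasure Q]

/-- The linear term `2 ∫ z(f) ξ(f, y) Q(df)` in the expansion of the test statistic. -/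
noncomputable def influence (ν Q : Measure H) (y : H) : ℝ := 2 * ∫ f, lawZ ν f * lawXi ν f y ∂Q

lemma abs_lawZ_mul_lawXi_le (h4 : Integrable (fun y => ‖y‖ ^ 4) ν) (f y : H) :
    |lawZ ν f * lawXi ν f y| ≤ 3 * (growthConst ν * (1 + ‖f‖ ^ 2) * (1 + ‖y‖ ^ 2)) := by
  rw [abs_mul]
  exact mul_le_mul (abs_lawZ_le f) (abs_lawXi_le_growth h4 f y) (abs_nonneg _) (by norm_num)

lemma measurable_lawZ_mul_lawXi :
    Measurable fun p : H × H => lawZ ν p.2 * lawXi ν p.2 p.1 :=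
  (measurable_lawZ.comp measurable_snd).mul (measurable_lawXi_comp measurable_snd measurable_fst)

lemma integrable_one_add_norm_sq (hQ : Integrable (fun f => ‖f‖ ^ 4) Q) :
    Integrable (fun f : H => 1 + ‖f‖ ^ 2) Q :=
  (memLp_one_add_norm_sq hQ).integrable (by norm_num)

lemma integrable_lawZ_mul_lawXi (h4 : Integrable (fun y => ‖y‖ ^ 4) ν)
    (hQ : Integrable (fun f => ‖f‖ ^ 4) Q) (y : H) :
    Integrable (fun f => lawZ ν f * lawXi ν f y) Q := by
  refine (((integrable_one_add_norm_sq hQ).const_mul (growthConst ν)).mul_const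
    (1 + ‖y‖ ^ 2)).const_mul 3 |>.mono' ?_ (ae_of_all _ fun f => abs_lawZ_mul_lawXi_le h4 f y)
  exact (measurable_lawZ.mul
    (measurable_lawXi_comp measurable_id measurable_const)).aestronglyMeasurable

lemma integrable_prod_lawZ_mul_lawXi (h4 : Integrable (fun y => ‖y‖ ^ 4) ν)
    (hQ : Integrable (fun f => ‖f‖ ^ 4) Q) :
    Integrable (fun p : H × H => lawZ ν p.2 * lawXi ν p.2 p.1) (ν.prod Q) := by
  refine (((integrable_one_add_norm_sq h4).mul_prod (integrable_one_add_norm_sq hQ)).const_mul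
    (3 * growthConst ν)).mono' measurable_lawZ_mul_lawXi.aestronglyMeasurable
    (ae_of_all _ fun p => (abs_lawZ_mul_lawXi_le h4 p.2 p.1).trans (le_of_eq ?_))
  ring

lemma measurable_influence : Measurable (influence ν Q) :=
  (StronglyMeasurable.integral_prod_right (f := fun y f : H => lawZ ν f * lawXi ν f y)
    measurable_lawZ_mul_lawXi.stronglyMeasurable).measurable.const_mul 2

/-- Integrating the product envelope over $Q$ leaves quadratic growth in $y$, which is
square-integrable under `ν`. -/
lemma memLp_influence (h4 : Integrable (fun y => ‖y‖ ^ 4) ν)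
    (hQ : Integrable (fun f => ‖f‖ ^ 4) Q) : MemLp (influence ν Q) 2 ν := by
  refine MemLp.of_le ((memLp_one_add_norm_sq h4).const_mul
    (2 * ∫ f, 3 * (growthConst ν * (1 + ‖f‖ ^ 2)) ∂Q)) measurable_influence.aestronglyMeasurable
    (ae_of_all _ fun y => le_trans ?_ (le_abs_self _))
  have h := norm_integral_le_of_norm_le (f := fun f => lawZ ν f * lawXi ν f y)
    ((((integrable_one_add_norm_sq hQ).const_mul (growthConst ν)).mul_const
      (1 + ‖y‖ ^ 2)).const_mul 3) (ae_of_all _ fun f => abs_lawZ_mul_lawXi_le h4 f y)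
  unfold influence
  rw [norm_mul, Real.norm_of_nonneg (by norm_num : (0 : ℝ) ≤ 2), mul_assoc, ← integral_mul_const]
  refine mul_le_mul_of_nonneg_left (h.trans (le_of_eq ?_)) (by norm_num)
  congr 1; ext f; ring

lemma integral_influence [CompleteSpace H] (h4 : Integrable (fun y => ‖y‖ ^ 4) ν)
    (h0 : ∫ y, y ∂ν = 0) (hQ : Integrable (fun f => ‖f‖ ^ 4) Q) :
    ∫ y, influence ν Q y ∂ν = 0 := by
  unfold influence
  rw [integral_const_mul, integral_integral_swap (integrable_prod_lawZ_mul_lawXi h4 hQ)]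
  simp_rw [integral_const_mul, integral_lawXi h4 h0]
  simp

/-- The integrand of the asymptotic variance, before integrating out the law `ν`. -/
lemma integrable_lawZ_mul_lawXi_mul (h4 : Integrable (fun y => ‖y‖ ^ 4) ν)
    (hQ : Integrable (fun f => ‖f‖ ^ 4) Q) :
    Integrable (fun q : H × (H × H) => (lawZ ν q.2.1 * lawXi ν q.2.1 q.1)
      * (lawZ ν q.2.2 * lawXi ν q.2.2 q.1)) (ν.prod (Q.prod Q)) := by
  have hm1 : Measurable fun q : H × (H × H) => lawZ ν q.2.1 * lawXi ν q.2.1 q.1 :=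
    (measurable_lawZ.comp measurable_snd.fst).mul
      (measurable_lawXi_comp measurable_snd.fst measurable_fst)
  have hm2 : Measurable fun q : H × (H × H) => lawZ ν q.2.2 * lawXi ν q.2.2 q.1 :=
    (measurable_lawZ.comp measurable_snd.snd).mul
      (measurable_lawXi_comp measurable_snd.snd measurable_fst)
  have hb := integrable_one_add_norm_sq hQ
  refine (((memLp_one_add_norm_sq h4).integrable_sq.mul_prod (hb.mul_prod hb)).const_mul
    (9 * growthConst ν ^ 2)).mono' (hm1.mul hm2).aestronglyMeasurable (ae_of_all _ fun q => ?_)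
  rw [norm_mul]
  refine (mul_le_mul (abs_lawZ_mul_lawXi_le h4 q.2.1 q.1) (abs_lawZ_mul_lawXi_le h4 q.2.2 q.1)
    (abs_nonneg _) ((abs_nonneg _).trans (abs_lawZ_mul_lawXi_le h4 q.2.1 q.1))).trans
    (le_of_eq ?_)
  ring

lemma integral_lawZ_mul_lawXi_mul (p : H × H) :
    ∫ y, (lawZ ν p.1 * lawXi ν p.1 y) * (lawZ ν p.2 * lawXi ν p.2 y) ∂ν
      = (∫ y, lawXi ν p.1 y * lawXi ν p.2 y ∂ν) * lawZ ν p.1 * lawZ ν p.2 := by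
  rw [← integral_mul_const, ← integral_mul_const]
  congr 1; ext y; ring

lemma integrable_covKernel_mul (h4 : Integrable (fun y => ‖y‖ ^ 4) ν)
    (hQ : Integrable (fun f => ‖f‖ ^ 4) Q) :
    Integrable (fun p : H × H => (∫ y, lawXi ν p.1 y * lawXi ν p.2 y ∂ν)
      * lawZ ν p.1 * lawZ ν p.2) (Q.prod Q) := by
  simp_rw [← integral_lawZ_mul_lawXi_mul]
  exact (integrable_lawZ_mul_lawXi_mul h4 hQ).integral_prod_right

/-- The asymptotic variance is the second moment of the linear term. -/
lemma integral_influence_sq (h4 : Integrable (fun y => ‖y‖ ^ 4) ν)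
    (hQ : Integrable (fun f => ‖f‖ ^ 4) Q) :
    ∫ y, influence ν Q y ^ 2 ∂ν
      = 4 * ∫ g, ∫ f, (∫ y, lawXi ν f y * lawXi ν g y ∂ν) * lawZ ν f * lawZ ν g ∂Q ∂Q := by
  rw [← integral_prod_symm _ (integrable_covKernel_mul h4 hQ)]
  simp_rw [← integral_lawZ_mul_lawXi_mul]
  -- With `ν` outermost, the integral over $Q\otimes Q$ factors into the square of $\int
  -- z(f)\,\xi(f,y)\,Q(df)$.
  rw [← integral_integral_swap (f := fun (y : H) (p : H × H) =>
    (lawZ ν p.1 * lawXi ν p.1 y) * (lawZ ν p.2 * lawXi ν p.2 y))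
    (integrable_lawZ_mul_lawXi_mul h4 hQ), ← integral_const_mul]
  congr 1; ext y
  rw [integral_prod_mul (fun f => lawZ ν f * lawXi ν f y) (fun f => lawZ ν f * lawXi ν f y)]
  unfold influence
  ring

lemma integrable_lawXi_mul_lawXi (h4 : Integrable (fun y => ‖y‖ ^ 4) ν) (f g : H) :
    Integrable (fun y => lawXi ν f y * lawXi ν g y) ν := by
  have h : ∀ f, MemLp (lawXi ν f) 2 ν := fun f =>
    MemLp.of_le ((memLp_one_add_norm_sq h4).const_mul (growthConst ν * (1 + ‖f‖ ^ 2)))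
      (measurable_lawXi_right f).aestronglyMeasurable
      (ae_of_all _ fun y => (abs_lawXi_le_growth h4 f y).trans (le_abs_self _))
  exact (h f).integrable_mul (h g)

end Influence

/-! ### Remainder of the linear expansion. -/

section Remainder

variable {H : Type*} [NormedAddCommGroup H] [InnerProductSpace ℝ H] [MeasurableSpace H]
  {n : ℕ} {ν Q : Measure H}

/-- The sum of the squared empirical means that dominates the remainder of the expansion. -/
noncomputable def remainderBound (ν : Measure H) (y : Fin n → H) (f : H) : ℝ :=
  ((n : ℝ)⁻¹ * ∑ j, lawXi ν f (y j)) ^ 2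
    + (((n : ℝ)⁻¹ * ∑ j, ⟪f, y j⟫) ^ 2
    + (((n : ℝ)⁻¹ * ∑ j, (Real.sin ⟪f, y j⟫ - Real.cos ⟪f, y j⟫ - (sinMean ν f - cosMean ν f))) ^ 2
    + ((n : ℝ)⁻¹ * ∑ j, (⟪f, y j⟫ ^ 2 - secondMoment ν f)) ^ 2))

/-- Residuals are translation invariant, so the sample may be centred at the unknown `m` before
expanding. -/
lemma inner_sub_sampleMean (hn : 0 < n) (x : Fin n → H) (m f : H) (j : Fin n) :
    ⟪f, x j - sampleMean x⟫ = ⟪f, x j - m⟫ - (n : ℝ)⁻¹ * ∑ i, ⟪f, x i - m⟫ := by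
  unfold sampleMean
  simp_rw [inner_sub_right, Finset.sum_sub_distrib]
  rw [mul_sub, average_const hn, inner_smul_right, inner_sum]
  ring

/-- Combines the two scalar expansions; $72=18\cdot4$, the largest coefficient of a squared average.
-/
lemma abs_empZ_sq_sub_le [IsProbabilityMeasure ν] (hn : 0 < n) (x : Fin n → H) (m f : H) :
    |empZ x f ^ 2 - lawZ ν f ^ 2 - 2 * lawZ ν f * ((n : ℝ)⁻¹ * ∑ j, lawXi ν f (x j - m))|
      ≤ 72 * remainderBound ν (fun j => x j - m) f := by
  have h := abs_empirical_sub_linear_le hn (fun j => ⟪f, x j - m⟫) (c := cosMean ν f)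
    (s := sinMean ν f) (secondMoment_nonneg (ν := ν) f)
  simp_rw [← inner_sub_sampleMean hn x m f] at h
  change |empZ x f - lawZ ν f - (n : ℝ)⁻¹ * ∑ j, lawXi ν f (x j - m)| ≤ _ at h
  refine (abs_sq_sub_sq_sub_linear_le (abs_empZ_le hn x f) (abs_lawZ_le f) h).trans ?_
  unfold remainderBound
  nlinarith [sq_nonneg ((n : ℝ)⁻¹ * ∑ j, lawXi ν f (x j - m)),
    sq_nonneg ((n : ℝ)⁻¹ * ∑ j, (Real.sin ⟪f, x j - m⟫ - Real.cos ⟪f, x j - m⟫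
      - (sinMean ν f - cosMean ν f))),
    sq_nonneg ((n : ℝ)⁻¹ * ∑ j, (⟪f, x j - m⟫ ^ 2 - secondMoment ν f))]

variable [SecondCountableTopology H] [BorelSpace H]
  [IsProbabilityMeasure ν] [IsProbabilityMeasure Q]

lemma enorm_sqrt_mul_sub_influence_le (h4 : Integrable (fun y => ‖y‖ ^ 4) ν)
    (hQ : Integrable (fun f => ‖f‖ ^ 4) Q) (hsymm : Q.map (fun f => -f) = Q) (hn : 0 < n)
    (x : Fin n → H) (m : H) :
    ‖√(n : ℝ) * (Tstat Q x - ∫ f, lawZ ν f ^ 2 ∂Q)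
        - (√(n : ℝ))⁻¹ * ∑ j, influence ν Q (x j - m)‖ₑ
      ≤ ∫⁻ f, ENNReal.ofReal (72 * √(n : ℝ) * remainderBound ν (fun j => x j - m) f) ∂Q := by
  have hn' : (0 : ℝ) < n := by exact_mod_cast hn
  have i1 : Integrable (fun f => empZ x f ^ 2) Q := by
    have hm : Measurable (empZ x) :=
      (continuous_empZ_uncurry.comp (Continuous.prodMk_right x)).measurable
    exact (MemLp.of_bound (p := 2) hm.aestronglyMeasurable 3
      (ae_of_all _ (abs_empZ_le hn x))).integrable_sq
  have i2 : Integrable (fun f => lawZ ν f ^ 2) Q :=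
    (MemLp.of_bound (p := 2) measurable_lawZ.aestronglyMeasurable 3
      (ae_of_all _ abs_lawZ_le)).integrable_sq
  have i3 : ∀ j, Integrable (fun f => lawZ ν f * lawXi ν f (x j - m)) Q := fun j =>
    integrable_lawZ_mul_lawXi h4 hQ _
  have i4 : Integrable (fun f => 2 * lawZ ν f * ((n : ℝ)⁻¹ * ∑ j, lawXi ν f (x j - m))) Q := by
    refine ((integrable_finsetSum Finset.univ fun j _ => i3 j).const_mul (2 * (n : ℝ)⁻¹)).congr
      (ae_of_all _ fun f => ?_)
    simp only [← Finset.mul_sum]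
    ring
  have e4 : ∫ f, 2 * lawZ ν f * ((n : ℝ)⁻¹ * ∑ j, lawXi ν f (x j - m)) ∂Q
      = (n : ℝ)⁻¹ * ∑ j, influence ν Q (x j - m) := by
    unfold influence
    rw [← Finset.mul_sum, ← integral_finsetSum _ fun j _ => i3 j, ← integral_const_mul,
      ← integral_const_mul]
    congr 1; ext f
    rw [← Finset.mul_sum]
    ring
  have hsq : (√(n : ℝ))⁻¹ = √(n : ℝ) * (n : ℝ)⁻¹ := by
    rw [← div_eq_mul_inv, Real.sqrt_div_self']
    simp
  have e5 : √(n : ℝ) * (Tstat Q x - ∫ f, lawZ ν f ^ 2 ∂Q)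
        - (√(n : ℝ))⁻¹ * ∑ j, influence ν Q (x j - m)
      = ∫ f, √(n : ℝ) * (empZ x f ^ 2 - lawZ ν f ^ 2
        - 2 * lawZ ν f * ((n : ℝ)⁻¹ * ∑ j, lawXi ν f (x j - m))) ∂Q := by
    have i12 : Integrable (fun f => empZ x f ^ 2 - lawZ ν f ^ 2) Q := i1.sub i2
    rw [integral_const_mul, integral_sub i12 i4, integral_sub i1 i2, e4,
      Tstat_eq_integral_sq hsymm hn, hsq]
    ring
  rw [e5]
  refine (enorm_integral_le_lintegral_enorm _).trans (lintegral_mono fun f => ?_)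
  rw [Real.enorm_eq_ofReal_abs]
  refine ENNReal.ofReal_le_ofReal ?_
  rw [abs_mul, abs_of_nonneg (Real.sqrt_nonneg _)]
  have := mul_le_mul_of_nonneg_left (abs_empZ_sq_sub_le (ν := ν) hn x m f)
    (Real.sqrt_nonneg (n : ℝ))
  linarith

variable [CompleteSpace H] {Ω : Type*} [MeasurableSpace Ω] {P : Measure Ω} [IsProbabilityMeasure P]
  {Y : ℕ → Ω → H}

/-- The bound for the mean of each of the squared empirical means. -/
noncomputable def momentConst (ν Q : Measure H) : ℝ :=
  (∫ f, (growthConst ν * (1 + ‖f‖ ^ 2)) ^ 2 ∂Q) * ∫ y, (1 + ‖y‖ ^ 2) ^ 2 ∂ν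

/-- Each of the four kernels is centred and obeys the common envelope, so each squared average costs
at most `momentConst` over `n`. -/
lemma lintegral_prod_remainderBound_le (h4 : Integrable (fun y => ‖y‖ ^ 4) ν)
    (h0 : ∫ y, y ∂ν = 0) (hQ : Integrable (fun f => ‖f‖ ^ 4) Q)
    (hY : ∀ j, AEMeasurable (Y j) P) (hlaw : ∀ j, P.map (Y j) = ν) (hind : iIndepFun Y P)
    (hn : 0 < n) :
    ∫⁻ p : Ω × H, ENNReal.ofReal (remainderBound ν (fun j : Fin n => Y j p.1) p.2) ∂P.prod Q
      ≤ 4 * ENNReal.ofReal ((n : ℝ)⁻¹ * momentConst ν Q) := by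
  have hb : Integrable (fun f : H => (growthConst ν * (1 + ‖f‖ ^ 2)) ^ 2) Q :=
    ((memLp_one_add_norm_sq hQ).const_mul (growthConst ν)).integrable_sq
  have hB := memLp_one_add_norm_sq h4
  have k1 := lintegral_prod_average_sq_le hY hlaw hind (h := lawXi ν) measurable_lawXi
    (integral_lawXi h4 h0) hb hB (abs_lawXi_le_growth h4) hn
  have k2 := lintegral_prod_average_sq_le hY hlaw hind (h := fun f y => ⟪f, y⟫)
    measurable_uncurry_inner (integral_inner_eq_zero h4 h0) hb hB abs_inner_le_growth hn
  have k3 := lintegral_prod_average_sq_le hY hlaw hind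
    (h := fun f y => Real.sin ⟪f, y⟫ - Real.cos ⟪f, y⟫ - (sinMean ν f - cosMean ν f))
    measurable_sin_sub_cos_sub integral_sin_sub_cos_sub hb hB abs_sin_sub_cos_sub_le_growth hn
  have k4 := lintegral_prod_average_sq_le hY hlaw hind
    (h := fun f y => ⟪f, y⟫ ^ 2 - secondMoment ν f)
    measurable_inner_sq_sub (integral_inner_sq_sub h4) hb hB (abs_inner_sq_sub_le_growth h4) hn
  have m1 := aemeasurable_average_sq (Q := Q) (n := n) hY (h := lawXi ν) measurable_lawXi
  have m2 := aemeasurable_average_sq (Q := Q) (n := n) hY (h := fun f y => ⟪f, y⟫)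
    measurable_uncurry_inner
  have m3 := aemeasurable_average_sq (Q := Q) (n := n) hY
    (h := fun f y => Real.sin ⟪f, y⟫ - Real.cos ⟪f, y⟫ - (sinMean ν f - cosMean ν f))
    measurable_sin_sub_cos_sub
  unfold remainderBound
  have hsplit : ∀ a b c d : ℝ, ENNReal.ofReal (a ^ 2 + (b ^ 2 + (c ^ 2 + d ^ 2)))
      = ENNReal.ofReal (a ^ 2) + (ENNReal.ofReal (b ^ 2)
        + (ENNReal.ofReal (c ^ 2) + ENNReal.ofReal (d ^ 2))) := fun a b c d => by
    rw [ENNReal.ofReal_add (by positivity) (by positivity),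
      ENNReal.ofReal_add (by positivity) (by positivity),
      ENNReal.ofReal_add (by positivity) (by positivity)]
  simp_rw [hsplit]
  rw [lintegral_add_left' m1, lintegral_add_left' m2, lintegral_add_left' m3]
  refine (add_le_add k1 (add_le_add k2 (add_le_add k3 k4))).trans (le_of_eq ?_)
  unfold momentConst
  ring

end Remainder

/-! ### Asymptotic linearity and the central limit theorem. -/

section Limit

variable {H : Type*} [NormedAddCommGroup H] [InnerProductSpace ℝ H] [CompleteSpace H]
  [SecondCountableTopology H] [MeasurableSpace H] [BorelSpace H]
  {ν Q : Measure H} [IsProbabilityMeasure ν] [IsProbabilityMeasure Q]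
  {Ω : Type*} [MeasurableSpace Ω] {P : Measure Ω} [IsProbabilityMeasure P] {Xs : ℕ → Ω → H} {m : H}

lemma aemeasurable_remainderBound {n : ℕ} {Y : ℕ → Ω → H} (hY : ∀ j, AEMeasurable (Y j) P) :
    AEMeasurable (fun p : Ω × H => remainderBound ν (fun j : Fin n => Y j p.1) p.2)
      (P.prod Q) := by
  have key : ∀ {h : H → H → ℝ}, Measurable (Function.uncurry h) →
      AEMeasurable (fun p : Ω × H => ((n : ℝ)⁻¹ * ∑ j : Fin n, h p.2 (Y j p.1)) ^ 2)
        (P.prod Q) := fun {h} hh =>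
    ((Finset.aemeasurable_fun_sum _ fun (j : Fin n) _ =>
      aemeasurable_prod_comp_left hY hh j).const_mul _).pow_const 2
  have k1 := key (h := lawXi ν) measurable_lawXi
  have k2 := key (h := fun f y => ⟪f, y⟫) measurable_uncurry_inner
  have k3 := key (h := fun f y => Real.sin ⟪f, y⟫ - Real.cos ⟪f, y⟫
    - (sinMean ν f - cosMean ν f)) measurable_sin_sub_cos_sub
  have k4 := key (h := fun f y => ⟪f, y⟫ ^ 2 - secondMoment ν f) measurable_inner_sq_sub
  unfold remainderBound
  exact k1.add (k2.add (k3.add k4))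

/-- The test statistic is asymptotically linear. -/
lemma eLpNorm_sqrt_mul_sub_influence_le (h4 : Integrable (fun y => ‖y‖ ^ 4) ν)
    (h0 : ∫ y, y ∂ν = 0) (hQ : Integrable (fun f => ‖f‖ ^ 4) Q)
    (hsymm : Q.map (fun f => -f) = Q)
    (hY : ∀ j, AEMeasurable (fun ω => Xs j ω - m) P)
    (hlaw : ∀ j, P.map (fun ω => Xs j ω - m) = ν) (hind : iIndepFun (fun j ω => Xs j ω - m) P)
    {n : ℕ} (hn : 0 < n) :
    eLpNorm (fun ω => √(n : ℝ) * (Tstat Q (fun j : Fin n => Xs j ω) - ∫ f, lawZ ν f ^ 2 ∂Q)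
        - (√(n : ℝ))⁻¹ * ∑ j ∈ Finset.range n, influence ν Q (Xs j ω - m)) 1 P
      ≤ ENNReal.ofReal (288 * momentConst ν Q * (√(n : ℝ))⁻¹) := by
  rw [eLpNorm_one_eq_lintegral_enorm]
  have hC : 0 ≤ 72 * √(n : ℝ) := by positivity
  calc _ ≤ ∫⁻ ω, ∫⁻ f, ENNReal.ofReal (72 * √(n : ℝ)
          * remainderBound ν (fun j : Fin n => Xs j ω - m) f) ∂Q ∂P := by
        refine lintegral_mono fun ω => ?_
        rw [Finset.sum_range]
        exact enorm_sqrt_mul_sub_influence_le h4 hQ hsymm hn (fun j => Xs j ω) m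
    _ = ENNReal.ofReal (72 * √(n : ℝ)) * ∫⁻ p : Ω × H,
          ENNReal.ofReal (remainderBound ν (fun j : Fin n => Xs j p.1 - m) p.2) ∂P.prod Q := by
        have hm := (aemeasurable_remainderBound (ν := ν) (Q := Q) (n := n) hY).ennreal_ofReal
        simp_rw [ENNReal.ofReal_mul hC]
        rw [← lintegral_const_mul'' _ hm, lintegral_prod _ (hm.const_mul _)]
    -- The factor $\sqrt n$ meets a mean of order $1/n$, which leaves $n^{-1/2}$; $288=72\cdot4$.
    _ ≤ ENNReal.ofReal (72 * √(n : ℝ)) * (4 * ENNReal.ofReal ((n : ℝ)⁻¹ * momentConst ν Q)) :=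
        mul_le_mul_right (lintegral_prod_remainderBound_le h4 h0 hQ hY hlaw hind hn) _
    _ = ENNReal.ofReal (288 * momentConst ν Q * (√(n : ℝ))⁻¹) := by
        have hsq : (√(n : ℝ))⁻¹ = √(n : ℝ) * (n : ℝ)⁻¹ := by
          rw [← div_eq_mul_inv, Real.sqrt_div_self']
          simp
        have h4' : (4 : ENNReal) = ENNReal.ofReal 4 := by simp
        rw [h4', ← ENNReal.ofReal_mul (by norm_num), ← ENNReal.ofReal_mul hC, hsq]
        congr 1
        ring

/-- The central limit theorem handles the sum of influences; the difference tends to zero in $L^1$,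
hence in measure, and Slutsky's lemma transfers the limit. -/
lemma tendstoInDistribution_Tstat (h4 : Integrable (fun y => ‖y‖ ^ 4) ν)
    (h0 : ∫ y, y ∂ν = 0) (hQ : Integrable (fun f => ‖f‖ ^ 4) Q)
    (hsymm : Q.map (fun f => -f) = Q) (hXs : ∀ j, AEMeasurable (Xs j) P)
    (hlaw : ∀ j, P.map (fun ω => Xs j ω - m) = ν) (hind : iIndepFun (fun j ω => Xs j ω - m) P)
    {v : ℝ≥0} (hv : (v : ℝ) = ∫ y, influence ν Q y ^ 2 ∂ν) :
    TendstoInDistribution (fun (n : ℕ) (ω : Ω) => √(n : ℝ) *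
        (Tstat Q (fun j : Fin n => Xs j ω) - ∫ f, lawZ ν f ^ 2 ∂Q))
      atTop (id : ℝ → ℝ) (fun _ => P) (gaussianReal 0 v) := by
  have hY : ∀ j, AEMeasurable (fun ω => Xs j ω - m) P := fun j => (hXs j).sub_const m
  have hid : ∀ j, IdentDistrib (fun ω => influence ν Q (Xs j ω - m)) (influence ν Q) P ν :=
    fun j => (IdentDistrib.mk (hY j) aemeasurable_id (by rw [hlaw j, Measure.map_id]) :
      IdentDistrib (fun ω => Xs j ω - m) id P ν).comp measurable_influence
  have hmean : ∫ ω, influence ν Q (Xs 0 ω - m) ∂P = 0 := by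
    rw [(hid 0).integral_eq, integral_influence h4 h0 hQ]
  have hvar : Var[fun ω => influence ν Q (Xs 0 ω - m); P] = v := by
    rw [(hid 0).variance_eq, variance_of_integral_eq_zero measurable_influence.aemeasurable
      (integral_influence h4 h0 hQ), hv]
  have hclt : TendstoInDistribution (fun (n : ℕ) ω =>
      (√(n : ℝ))⁻¹ * ∑ j ∈ Finset.range n, influence ν Q (Xs j ω - m))
      atTop (id : ℝ → ℝ) (fun _ => P) (gaussianReal 0 v) := by
    have h := tendstoInDistribution_inv_sqrt_mul_sum_sub (P := P) (P' := gaussianReal 0 v)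
      (X := fun j ω => influence ν Q (Xs j ω - m)) (Y := id)
      (by rw [hvar, Real.toNNReal_coe]; exact HasLaw.id)
      ((hid 0).memLp_iff.2 (memLp_influence h4 hQ))
      (hind.comp (fun _ => influence ν Q) fun _ => measurable_influence)
      (fun i => (hid i).trans (hid 0).symm)
    simpa only [hmean, mul_zero, sub_zero] using h
  have hT : ∀ n : ℕ, AEMeasurable (fun ω => √(n : ℝ) *
      (Tstat Q (fun j : Fin n => Xs j ω) - ∫ f, lawZ ν f ^ 2 ∂Q)) P := fun n =>
    ((measurable_Tstat.comp_aemeasurable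
      (aemeasurable_pi_lambda _ fun j : Fin n => hXs j)).sub_const _).const_mul _
  refine tendstoInDistribution_of_tendstoInMeasure_sub _ _ hclt ?_ hT
  refine tendstoInMeasure_of_tendsto_eLpNorm one_ne_zero
    (fun n => ((hT n).sub (hclt.forall_aemeasurable n)).aestronglyMeasurable)
    aestronglyMeasurable_zero ?_
  have hlim : Tendsto (fun n : ℕ => ENNReal.ofReal (288 * momentConst ν Q * (√(n : ℝ))⁻¹))
      atTop (𝓝 0) := by
    rw [← ENNReal.ofReal_zero, ← mul_zero (288 * momentConst ν Q)]
    exact ENNReal.tendsto_ofReal ((tendsto_inv_atTop_zero.comp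
      (Real.tendsto_sqrt_atTop.comp tendsto_natCast_atTop_atTop)).const_mul _)
  refine tendsto_of_tendsto_of_tendsto_of_le_of_le' tendsto_const_nhds hlim
    (Eventually.of_forall fun n => zero_le) ?_
  -- The expansion divides by `n`, so the empty sample is discarded.
  filter_upwards [eventually_gt_atTop 0] with n hn
  rw [sub_zero]
  exact eLpNorm_sqrt_mul_sub_influence_le h4 h0 hQ hsymm hY hlaw hind hn

end Limit

end GaussTest

/-! ### The limit theorem. -/

theorem mainTheorem4
    {H : Type*} [NormedAddCommGroup H] [InnerProductSpace ℝ H] [CompleteSpace H]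
    [SecondCountableTopology H] [MeasurableSpace H] [BorelSpace H]
    {Ω₀ : Type*} [MeasurableSpace Ω₀] (P₀ : Measure Ω₀) [IsProbabilityMeasure P₀]
    {Ω : Type*} [MeasurableSpace Ω] (P : Measure Ω) [IsProbabilityMeasure P]
    -- the random element `X` and its iid copies
    (X : Ω₀ → H) (Xs : ℕ → Ω → H)
    (hindep : iIndepFun Xs P)
    (hident : ∀ j, IdentDistrib (Xs j) X P P₀)
    (hX : Integrable (fun ω => ‖X ω‖ ^ 4) P₀)
    -- the symmetric weight measure `Q`
    (Q : Measure H) [IsProbabilityMeasure Q]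
    (hsymm : Q.map (fun f => -f) = Q)
    (hQ : Integrable (fun f => ‖f‖ ^ 4) Q) :
    -- the integrals that define the variance converge
    (∀ f g : H, Integrable (fun ω =>
      GaussTest.xi (GaussTest.centred X P₀) P₀ f (GaussTest.centred X P₀ ω) *
        GaussTest.xi (GaussTest.centred X P₀) P₀ g (GaussTest.centred X P₀ ω)) P₀) ∧
    Integrable (fun p : H × H =>
      GaussTest.Kstar (GaussTest.centred X P₀) P₀ p.1 p.2 *
        GaussTest.zFun (GaussTest.centred X P₀) P₀ p.1 *
        GaussTest.zFun (GaussTest.centred X P₀) P₀ p.2) (Q.prod Q) ∧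
    ∃ v : ℝ≥0,
      (v : ℝ) = 4 * ∫ g, ∫ f, GaussTest.Kstar (GaussTest.centred X P₀) P₀ f g *
        GaussTest.zFun (GaussTest.centred X P₀) P₀ f *
        GaussTest.zFun (GaussTest.centred X P₀) P₀ g ∂Q ∂Q ∧
      TendstoInDistribution
        (fun (n : ℕ) (ω : Ω) => √(n : ℝ) *
          (GaussTest.Tstat Q (fun j : Fin n => Xs j ω) - GaussTest.tau Q X P₀))
        atTop (id : ℝ → ℝ) (fun _ => P) (gaussianReal 0 v) := by

  have hXm : AEMeasurable X P₀ := (hident 0).aemeasurable_snd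
  have hν := GaussTest.isProbabilityMeasure_centredLaw hXm
  have h4 := GaussTest.integrable_centredLaw_pow_four hXm hX
  have h0 := GaussTest.integral_centredLaw hXm hX
  simp_rw [GaussTest.xi_centred hXm hX, GaussTest.Kstar_centred hXm hX,
    GaussTest.zFun_centred hXm hX, GaussTest.tau_eq_integral_sq hsymm hXm hX]
  -- The variance is supplied as the second moment of the influence function, which makes
  -- $\sigma^2\ge0$ evident.
  refine ⟨fun f g => ?_, GaussTest.integrable_covKernel_mul h4 hQ,
    ⟨∫ y, GaussTest.influence (GaussTest.centredLaw X P₀) Q y ^ 2 ∂GaussTest.centredLaw X P₀,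
      integral_nonneg fun _ => sq_nonneg _⟩, GaussTest.integral_influence_sq h4 hQ, ?_⟩
  · exact (integrable_map_measure
      ((GaussTest.measurable_lawXi_right f).mul
        (GaussTest.measurable_lawXi_right g)).aestronglyMeasurable
      (GaussTest.aemeasurable_centred hXm)).1 (GaussTest.integrable_lawXi_mul_lawXi h4 f g)
  · exact GaussTest.tendstoInDistribution_Tstat (m := GaussTest.mean X P₀) h4 h0 hQ hsymm
      (fun j => (hident j).aemeasurable_fst)
      (fun j => ((hident j).comp (measurable_id.sub_const (GaussTest.mean X P₀))).map_eq)
      (hindep.comp (fun _ x => x - GaussTest.mean X P₀) fun _ => measurable_id.sub_const _) rfl
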